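/- Let $n\ge 8$ and $m=n-4$. Let $\mathrm{B}_n$ be the Coxeter group of type $\mathrm{B}_n$, realised as the subgroup of $\mathrm{Sym}(\{1,\ldots,2n\})$ generated by its simple reflections $\beta_0=(1,n+1)$ and $\beta_j=(j,j+1)(n+j,n+j+1)$ for $1\le j\le n-1$; that is, the assignment of the simple reflections to the $\beta_j$ in the order of the Coxeter diagram (the edge labelled $4$ joining $\beta_0$ and $\beta_1$) extends to an injective homomorphism $\mathrm{B}_n\to\mathrm{Sym}(\{1,\ldots,2n\})$. (Reading $n+i$ as $-i$, these are signed permutations.) A *C-string of rank $m$* for a group $G$ is a set of $m$ involutions $\{t_1,\ldots,t_m\}$, in this order, such that $G=\langle t_1,\ldots,t_m\rangle$, such that $t_i$ and $t_j$ commute whenever $|i-j|\ge 2$, and such that $G_J\cap G_K=G_{J\cap K}$ for all $J,K\subseteq\{1,\ldots,m\}$, where $G_J=\langle t_j\mid j\in J\rangle$. Its *Schläfli symbol* is the sequence of the orders of $t_1t_2,\,t_2t_3,\ldots,t_{m-1}t_m$. A C-string for $G$ is *unravelled* if, for every normal subgroup $N$ of $G$ with $1\ne N\ne G$, the images $\overline{t_1},\ldots,\overline{t_m}$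 in $G/N$ are either not pairwise distinct, or are pairwise distinct but do not form a C-string for $G/N$. Then the permutations $$t_1=(2,3)(n+2,n+3)(4,5)(n+4,n+5)\prod_{i=6}^n(i,n+i),$$ $$t_2=(1,2)(n+1,n+2)(3,4)(n+3,n+4)(5,6)(n+5,n+6)\prod_{i=7}^n(i,n+i),$$ $$t_3=(2,3)(n+2,n+3)(6,7)(n+6,n+7),$$ $$t_k=(k+3,k+4)(n+k+3,n+k+4)\qquad(4\le k\le m)$$ lie in $\mathrm{B}_n$, and $\{t_1,\ldots,t_m\}$ is a C-string of rank $m$ for $\mathrm{B}_n$ with Schläfli symbol $[12,12,6,3,\ldots,3]$, in which the entry $3$ occurs $n-8$ times. Moreover, when $n$ is even, this C-string is unravelled. -/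

import Mathlib

/-! ### C-strings -/

/-- `t 0, …, t (m-1)` is a C-string of rank `m` for the group `G`: the `t i` are `m` distinct
involutions generating `G`, `t i` and `t j` commute whenever `|i - j| ≥ 2`, and, writing `G_J` for
the subgroup generated by the `t j` with `j ∈ J`, `G_J ∩ G_K = G_{J ∩ K}` for all sets of indices
`J` and `K`. -/
structure IsCString {G : Type*} [Group G] {m : ℕ} (t : Fin m → G) : Prop where
  injective : Function.Injective t
  involution : ∀ i, orderOf (t i) = 2
  generate : Subgroup.closure (Set.range t) = ⊤
  string : ∀ i j : Fin m, (i : ℕ) + 2 ≤ j → Commute (t i) (t j)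
  intersection : ∀ J K : Set (Fin m),
    Subgroup.closure (t '' J) ⊓ Subgroup.closure (t '' K) = Subgroup.closure (t '' (J ∩ K))

/-- The C-string `t` for `G` is `N`-unravelled: either the images of the `t i` in `G ⧸ N` are not
pairwise distinct, or they are pairwise distinct but do not form a C-string for `G ⧸ N`. -/
def IsUnravelledAt {G : Type*} [Group G] {m : ℕ} (t : Fin m → G)
    (N : Subgroup G) [N.Normal] : Prop :=
  ¬ Function.Injective (fun i => (t i : G ⧸ N)) ∨
    (Function.Injective (fun i => (t i : G ⧸ N)) ∧ ¬ IsCString (fun i => (t i : G ⧸ N)))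

/-- `t` is an unravelled C-string for `G`: it is a C-string for `G` which is `N`-unravelled for
every non-trivial proper normal subgroup `N` of `G`. -/
def IsUnravelledCString {G : Type*} [Group G] {m : ℕ} (t : Fin m → G) : Prop :=
  IsCString t ∧
    ∀ (N : Subgroup G) [N.Normal], N ≠ ⊥ → N ≠ ⊤ → IsUnravelledAt t N

/-- The Schläfli symbol of `t`: the list of the orders of the products of consecutive members. -/
noncomputable def schlafliSymbol {G : Type*} [Group G] {m : ℕ} (t : Fin m → G) : List ℕ :=
  List.ofFn fun i : Fin (m - 1) => orderOf (t ⟨i, by omega⟩ * t ⟨i + 1, by omega⟩)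

/-! ### Permutations of `Ω = {1, …, 2n}`

`Ω` is modelled by `Fin n ⊕ Fin n`. Points are numbered from `1` as on paper: the point `k` with
`1 ≤ k ≤ n` is `Sum.inl (pt k)`, and the point `n + k` is `Sum.inr (pt k)`. Reading `n + k` as
`-k`, the permutations below are signed permutations of `{±1, …, ±n}`. -/

/-- The index `k`, where `1 ≤ k ≤ n`. -/
def pt {n : ℕ} (k : ℕ) (h : 1 ≤ k ∧ k ≤ n := by omega) : Fin n :=
  ⟨k - 1, by omega⟩

/-- The permutation `(a, b)(n + a, n + b)`. -/
def dswap {n : ℕ} (a b : Fin n) : Equiv.Perm (Fin n ⊕ Fin n) :=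
  Equiv.swap (Sum.inl a) (Sum.inl b) * Equiv.swap (Sum.inr a) (Sum.inr b)

/-- The permutation `∏_{i=k}^{n} (i, n + i)`. -/
def negFrom (n k : ℕ) : Equiv.Perm (Fin n ⊕ Fin n) where
  toFun x := if k ≤ (Sum.elim id id x : Fin n).val + 1 then x.swap else x
  invFun x := if k ≤ (Sum.elim id id x : Fin n).val + 1 then x.swap else x
  left_inv x := by
    rcases x with x | x <;> by_cases h : k ≤ (x : ℕ) + 1 <;> simp [h]
  right_inv x := by
    rcases x with x | x <;> by_cases h : k ≤ (x : ℕ) + 1 <;> simp [h]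

/-- The permutations `β_0 = (1, n + 1)` and `β_j = (j, j + 1)(n + j, n + j + 1)` for
`1 ≤ j ≤ n - 1`. -/
def betaPerm {n : ℕ} (j : Fin n) : Equiv.Perm (Fin n ⊕ Fin n) :=
  if h : (j : ℕ) = 0 then Equiv.swap (Sum.inl j) (Sum.inr j)
  else dswap (pt (j : ℕ)) (pt ((j : ℕ) + 1))

/-- The permutations `t_1, …, t_m` of `Ω`, where `n ≥ 8` and `m = n - 4`; the index `i : Fin (n-4)`
stands for `t_{i+1}`:
* `t_1 = (2,3)(n+2,n+3)(4,5)(n+4,n+5) ∏_{i=6}^n (i,n+i)`,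
* `t_2 = (1,2)(n+1,n+2)(3,4)(n+3,n+4)(5,6)(n+5,n+6) ∏_{i=7}^n (i,n+i)`,
* `t_3 = (2,3)(n+2,n+3)(6,7)(n+6,n+7)`,
* `t_k = (k+3,k+4)(n+k+3,n+k+4)` for `4 ≤ k ≤ m`. -/
def tPerm (n : ℕ) (hn : 8 ≤ n) (i : Fin (n - 4)) : Equiv.Perm (Fin n ⊕ Fin n) :=
  if (i : ℕ) + 1 = 1 then dswap (pt 2) (pt 3) * dswap (pt 4) (pt 5) * negFrom n 6
  else if (i : ℕ) + 1 = 2 then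
    dswap (pt 1) (pt 2) * dswap (pt 3) (pt 4) * dswap (pt 5) (pt 6) * negFrom n 7
  else if (i : ℕ) + 1 = 3 then dswap (pt 2) (pt 3) * dswap (pt 6) (pt 7)
  else dswap (pt ((i : ℕ) + 1 + 3)) (pt ((i : ℕ) + 1 + 4))

/-! The representation by signed permutations is faithful because the Coxeter group of type
`B_{k+1}` is a union of the cosets `c · B_k` for `2 (k + 1)` elements `c`, which move the last
coordinate to distinct signed coordinates.

Conjugating by the sign change of the fifth coordinate turns `t_2` into `X · (5 6)`, where
`X = (1 2)(3 4) ∏_{i ≥ 5} (i, -i)` commutes with the permutations of the coordinates `5, …, n`.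
It suffices to check the intersection property for the intervals `[a, b)` and `[a + 1, b + 1)` of
indices. An interval starting after `t_2` generates essentially a symmetric group on consecutive
coordinates, one starting at `t_2` generates `⟨X, (2 3)⟩` times such a group, and the first three
generators are handled by a computation in seven coordinates and one further sign, where the
determinant excludes the transpositions.

If `n` is even, every non-trivial normal subgroup of `B_n` contains `-1`. Now
`(2 3) · (-1)` lies in `⟨t_1, t_2, t_3⟩`, whereas `(2 3) = (t_3 t_4) ^ 3`. So if the images in a
quotient formed a C-string, the image of `(2 3)` would lie in that of `⟨t_3⟩`; then the kernel
contains a transposition and, by conjugation, also `t_4`, whose image would not be an involution. -/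

section Groups

variable {G : Type*} [Group G]

theorem exists_mul_eq_of_mem_sup_of_commute {H K : Subgroup G}
    (hc : ∀ h ∈ H, ∀ k ∈ K, Commute h k) {x : G} (hx : x ∈ H ⊔ K) :
    ∃ h ∈ H, ∃ k ∈ K, h * k = x := by
  have hrange := MonoidHom.noncommCoprod_range H.subtype K.subtype fun h k => hc h h.2 k k.2
  rw [H.range_subtype, K.range_subtype] at hrange
  rw [← hrange] at hx
  obtain ⟨⟨h, k⟩, rfl⟩ := hx
  exact ⟨h, h.2, k, k.2, rfl⟩

theorem commute_of_mem_closure {S T : Set G} (hc : ∀ s ∈ S, ∀ t ∈ T, Commute s t) {x y : G}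
    (hx : x ∈ Subgroup.closure S) (hy : y ∈ Subgroup.closure T) : Commute x y := by
  have hS : S ⊆ Subgroup.centralizer (Subgroup.closure T : Set G) := by
    rw [Subgroup.centralizer_closure]
    exact fun s hs => Subgroup.mem_centralizer_iff.2 fun t ht => (hc s hs t ht).symm.eq
  exact (Subgroup.mem_centralizer_iff.1 ((Subgroup.closure_le _).2 hS hx) y hy).symm

theorem closure_induction_of_mul_self_eq_one {S : Set G} (hS : ∀ s ∈ S, s * s = 1) {p : G → Prop}
    (one : p 1) (mul_left : ∀ s ∈ S, ∀ x, p x → p (s * x)) {g : G}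
    (hg : g ∈ Subgroup.closure S) : p g := by
  induction hg using Subgroup.closure_induction_left with
  | one => exact one
  | mul_left s hs x _ ih => exact mul_left s hs x ih
  | inv_mul_cancel s hs x _ ih =>
    rw [inv_eq_of_mul_eq_one_right (hS s hs)]
    exact mul_left s hs x ih

theorem conj_mem_of_mem_normalizer {H : Subgroup G} {s g : G}
    (hs : s ∈ Subgroup.normalizer (H : Set G)) (hg : g ∈ H) : s * g * s⁻¹ ∈ H :=
  (Subgroup.mem_normalizer_iff.1 hs g).1 hg

end Groups

/-! ### The intersection property of groups generated by strings -/

/-- The subgroup `G_J` generated by the `T j` with `j ∈ J`. -/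
def genSubgroup {G ι : Type*} [Group G] (T : ι → G) (J : Set ι) : Subgroup G :=
  Subgroup.closure (T '' J)

section GenSubgroup

variable {G ι : Type*} [Group G] {T : ι → G}

theorem mem_genSubgroup {J : Set ι} {j : ι} (hj : j ∈ J) : T j ∈ genSubgroup T J :=
  Subgroup.subset_closure ⟨j, hj, rfl⟩

theorem genSubgroup_le {J : Set ι} {H : Subgroup G} :
    genSubgroup T J ≤ H ↔ ∀ j ∈ J, T j ∈ H := by
  rw [genSubgroup, Subgroup.closure_le, Set.image_subset_iff]
  rfl

theorem genSubgroup_mono {J K : Set ι} (h : J ⊆ K) : genSubgroup T J ≤ genSubgroup T K :=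
  Subgroup.closure_mono (Set.image_mono h)

theorem genSubgroup_union (J K : Set ι) :
    genSubgroup T (J ∪ K) = genSubgroup T J ⊔ genSubgroup T K := by
  rw [genSubgroup, Set.image_union, Subgroup.closure_union, genSubgroup, genSubgroup]

theorem genSubgroup_empty : genSubgroup T (∅ : Set ι) = ⊥ := by
  rw [genSubgroup, Set.image_empty, Subgroup.closure_empty]

theorem genSubgroup_singleton (i : ι) : genSubgroup T {i} = Subgroup.zpowers (T i) := by
  rw [genSubgroup, Set.image_singleton, Subgroup.zpowers_eq_closure]

theorem genSubgroup_comp {κ : Type*} (e : κ → ι) (J : Set κ) :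
    genSubgroup (fun k => T (e k)) J = genSubgroup T (e '' J) := by
  rw [genSubgroup, genSubgroup, Set.image_image]

theorem map_genSubgroup {H : Type*} [Group H] (f : G →* H) (J : Set ι) :
    (genSubgroup T J).map f = genSubgroup (fun j => f (T j)) J := by
  rw [genSubgroup, genSubgroup, MonoidHom.map_closure, Set.image_image]

theorem exists_mem_genSubgroup_inter {H : Type*} [Group H] {f : G →* H} {J K : Set ι}
    (hJK : genSubgroup (fun i => f (T i)) J ⊓ genSubgroup (fun i => f (T i)) K ≤
      genSubgroup (fun i => f (T i)) (J ∩ K))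
    {x y : G} (hx : x ∈ genSubgroup T J) (hy : y ∈ genSubgroup T K) (hxy : f x = f y) :
    ∃ z ∈ genSubgroup T (J ∩ K), f z = f x := by
  rw [← map_genSubgroup, ← map_genSubgroup, ← map_genSubgroup] at hJK
  exact hJK ⟨⟨x, hx, rfl⟩, ⟨y, hy, hxy.symm⟩⟩

end GenSubgroup

section String

variable {G : Type*} [Group G] {T : ℕ → G} {m : ℕ}

theorem exists_mul_eq_of_mem_genSubgroup (hcomm : ∀ i j, i + 2 ≤ j → Commute (T i) (T j))
    {J : Set ℕ} {k : ℕ} (hk : k ∉ J) {g : G} (hg : g ∈ genSubgroup T J) :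
    ∃ x ∈ genSubgroup T (J ∩ Set.Iio k), ∃ y ∈ genSubgroup T (J ∩ Set.Ioi k), x * y = g := by
  refine exists_mul_eq_of_mem_sup_of_commute (H := genSubgroup T _) (K := genSubgroup T _)
    (fun x hx y hy => commute_of_mem_closure ?_ hx hy) ?_
  · rintro _ ⟨p, ⟨-, hp⟩, rfl⟩ _ ⟨q, ⟨-, hq⟩, rfl⟩
    exact hcomm p q (by rw [Set.mem_Iio] at hp; rw [Set.mem_Ioi] at hq; omega)
  · have hJ : J ⊆ Set.Iio k ∪ Set.Ioi k := fun j hj => lt_or_gt_of_ne (ne_of_mem_of_not_mem hj hk)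
    rwa [← genSubgroup_union, ← Set.inter_union_distrib_left, Set.inter_eq_left.2 hJ]

section

variable (hadj : ∀ a b, a < b → b < m →
  genSubgroup T (Set.Ico a b) ⊓ genSubgroup T (Set.Ico (a + 1) (b + 1)) ≤
    genSubgroup T (Set.Ico (a + 1) b))
include hadj

theorem genSubgroup_Ico_inf_Ico_succ_le {a j b : ℕ} (haj : a < j) (hjb : j ≤ b) (hb : b ≤ m) :
    genSubgroup T (Set.Ico a j) ⊓ genSubgroup T (Set.Ico (a + 1) b) ≤
      genSubgroup T (Set.Ico (a + 1) j) := by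
  induction b, hjb using Nat.le_induction with
  | base => exact inf_le_right
  | succ b hjb ih =>
    rintro g ⟨hgj, hgb⟩
    have hgab := genSubgroup_mono (Set.Ico_subset_Ico_right hjb) hgj
    exact ih (by omega) ⟨hgj, hadj a b (by omega) (by omega) ⟨hgab, hgb⟩⟩

theorem genSubgroup_Ico_inf_Ico_le {a i j b : ℕ} (hai : a ≤ i) (hij : i ≤ j) (hjb : j ≤ b)
    (hb : b ≤ m) :
    genSubgroup T (Set.Ico a j) ⊓ genSubgroup T (Set.Ico i b) ≤ genSubgroup T (Set.Ico i j) := by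
  induction i, hai using Nat.le_induction with
  | base => exact inf_le_left
  | succ i _ ih =>
    rintro g ⟨hgj, hgb⟩
    have hgi := ih (by omega) ⟨hgj, genSubgroup_mono (Set.Ico_subset_Ico_left i.le_succ) hgb⟩
    exact genSubgroup_Ico_inf_Ico_succ_le hadj hij hjb hb ⟨hgi, hgb⟩

variable (hcomm : ∀ i j, i + 2 ≤ j → Commute (T i) (T j))
include hcomm

theorem genSubgroup_Ico_inf_sdiff_singleton_le {a c j d b : ℕ} (hac : a ≤ c) (hcj : c ≤ j)
    (hjd : j < d) (hdb : d ≤ b) (hb : b ≤ m) :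
    genSubgroup T (Set.Ico c d) ⊓ genSubgroup T (Set.Ico a b \ {j}) ≤
      genSubgroup T (Set.Ico c d \ {j}) := by
  rintro g ⟨hg, hgj⟩
  obtain ⟨x, hx, y, hy, rfl⟩ :=
    exists_mul_eq_of_mem_genSubgroup hcomm (fun h : j ∈ Set.Ico a b \ {j} => h.2 rfl) hgj
  replace hx : x ∈ genSubgroup T (Set.Ico a j) := genSubgroup_mono (by grind) hx
  replace hy : y ∈ genSubgroup T (Set.Ico (j + 1) b) := genSubgroup_mono (by grind) hy
  have hx' : x ∈ genSubgroup T (Set.Ico c j) := by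
    refine genSubgroup_Ico_inf_Ico_le hadj hac hcj (by omega) hb ⟨hx, ?_⟩
    rw [← mul_inv_cancel_right x y]
    exact Subgroup.mul_mem _ (genSubgroup_mono (Set.Ico_subset_Ico_right hdb) hg)
      (Subgroup.inv_mem _ (genSubgroup_mono (Set.Ico_subset_Ico_left (by omega)) hy))
  have hy' : y ∈ genSubgroup T (Set.Ico (j + 1) d) := by
    refine genSubgroup_Ico_inf_Ico_le hadj (a := c) (by omega) hjd hdb hb ⟨?_, hy⟩
    rw [← inv_mul_cancel_left x y]
    exact Subgroup.mul_mem _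
      (Subgroup.inv_mem _ (genSubgroup_mono (Set.Ico_subset_Ico_right hjd.le) hx')) hg
  exact mul_mem (genSubgroup_mono (by grind) hx') (genSubgroup_mono (by grind) hy')

theorem genSubgroup_inf_Ico_sdiff_singleton_le {a b j : ℕ} (hb : b ≤ m) {J : Set ℕ}
    (hJ : J ⊆ Set.Ico a b) :
    genSubgroup T J ⊓ genSubgroup T (Set.Ico a b \ {j}) ≤ genSubgroup T (J \ {j}) := by
  obtain ⟨l, hl⟩ : ∃ l, b ≤ a + l := ⟨b, by omega⟩
  induction l generalizing a b J with
  | zero =>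
    have hJe : J = ∅ := Set.subset_eq_empty hJ (Set.Ico_eq_empty (by omega))
    rw [hJe, Set.empty_sdiff]
    exact inf_le_left
  | succ l ih =>
    rintro g ⟨hgJ, hgj⟩
    by_cases hjJ : j ∈ J
    swap
    · rwa [Set.sdiff_singleton_eq_self hjJ]
    by_cases hJI : J = Set.Ico a b
    · rwa [hJI]
    obtain ⟨i, hi, hiJ⟩ := Set.exists_of_ssubset (hJ.ssubset_of_ne hJI)
    have hij : i ≠ j := (ne_of_mem_of_not_mem hjJ hiJ).symm
    have hj := hJ hjJ
    rw [Set.mem_Ico] at hi hj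
    -- The factor of `g` on the side of `i` away from `j` already lies in `G_{J \ {j}}`; the other
    -- factor lives on a shorter interval.
    have restrict : ∀ c d, a ≤ c → c ≤ j → j < d → d ≤ b → d ≤ c + l →
        ∀ x ∈ genSubgroup T (J ∩ Set.Ico c d), x ∈ genSubgroup T (Set.Ico a b \ {j}) →
          x ∈ genSubgroup T (J \ {j}) := by
      intro c d hac hcj hjd hdb hl' x hxJ hxj
      have hxI := genSubgroup_mono Set.inter_subset_right hxJ
      have hxj' := genSubgroup_Ico_inf_sdiff_singleton_le hadj hcomm hac hcj hjd hdb hb ⟨hxI, hxj⟩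
      exact genSubgroup_mono (Set.sdiff_subset_sdiff_left Set.inter_subset_left)
        (ih (hdb.trans hb) Set.inter_subset_right hl' ⟨hxJ, hxj'⟩)
    obtain ⟨x, hx, y, hy, rfl⟩ := exists_mul_eq_of_mem_genSubgroup hcomm hiJ hgJ
    have hsub : J \ {j} ⊆ Set.Ico a b \ {j} := Set.sdiff_subset_sdiff_left hJ
    rcases hij.lt_or_gt with hij | hij
    · have hx' : x ∈ genSubgroup T (J \ {j}) := genSubgroup_mono (by grind) hx
      refine mul_mem hx' (restrict (i + 1) b (by omega) hij hj.2 le_rfl (by omega)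
        y (genSubgroup_mono (by grind) hy) ?_)
      exact (mul_mem_cancel_left (genSubgroup_mono hsub hx')).1 hgj
    · have hy' : y ∈ genSubgroup T (J \ {j}) := genSubgroup_mono (by grind) hy
      refine mul_mem (restrict a i le_rfl hj.1 hij hi.2.le (by omega)
        x (genSubgroup_mono (by grind) hx) ?_) hy'
      exact (mul_mem_cancel_right (genSubgroup_mono hsub hy')).1 hgj

theorem genSubgroup_inf_genSubgroup {J K : Set ℕ} (hJ : J ⊆ Set.Iio m) (hK : K ⊆ Set.Iio m) :
    genSubgroup T J ⊓ genSubgroup T K = genSubgroup T (J ∩ K) := by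
  refine le_antisymm ?_ (le_inf (genSubgroup_mono Set.inter_subset_left)
    (genSubgroup_mono Set.inter_subset_right))
  -- Remove the elements of `J` outside `K` one at a time.
  suffices remove : ∀ F ⊆ J \ K, F.Finite →
      genSubgroup T J ⊓ genSubgroup T K ≤ genSubgroup T (J \ F) by
    have hfin : (J \ K).Finite := (Set.finite_Iio m).subset (Set.sdiff_subset.trans hJ)
    simpa only [Set.sdiff_sdiff_right_self] using remove (J \ K) subset_rfl hfin
  intro F hF hfin
  induction F, hfin using Set.Finite.induction_on with
  | empty =>
    rw [Set.sdiff_empty]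
    exact inf_le_left
  | @insert j F _ _ ih =>
    obtain ⟨hj, hF⟩ := Set.insert_subset_iff.1 hF
    have hKj : K ⊆ Set.Ico 0 m \ {j} := by grind
    rw [← Set.union_singleton, ← Set.sdiff_sdiff]
    exact (le_inf (ih hF) (inf_le_right.trans (genSubgroup_mono hKj))).trans
      (genSubgroup_inf_Ico_sdiff_singleton_le hadj hcomm le_rfl (by grind))

end

end String

namespace IsCString

variable {G H : Type*} [Group G] [Group H] {m : ℕ} {t : Fin m → G}

theorem of_injective {f : G →* H} (hf : Function.Injective f) {T : ℕ → H}
    (hfT : ∀ i, f (t i) = T i) (hord : ∀ i < m, orderOf (T i) = 2)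
    (hcomm : ∀ i j, i + 2 ≤ j → Commute (T i) (T j))
    (hadj : ∀ a b, a < b → b < m →
      genSubgroup T (Set.Ico a b) ⊓ genSubgroup T (Set.Ico (a + 1) (b + 1)) ≤
        genSubgroup T (Set.Ico (a + 1) b))
    (hgen : f.range ≤ genSubgroup T (Set.Iio m)) : IsCString t := by
  have hmap : ∀ J : Set (Fin m),
      (genSubgroup t J).map f = genSubgroup T (Fin.val '' J) := fun J => by
    rw [map_genSubgroup, ← genSubgroup_comp, funext hfT]
  have hval : ∀ J : Set (Fin m), Fin.val '' J ⊆ Set.Iio m := by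
    rintro J _ ⟨i, -, rfl⟩
    exact i.2
  have hinf : ∀ J K : Set (Fin m), genSubgroup t J ⊓ genSubgroup t K = genSubgroup t (J ∩ K) := by
    intro J K
    apply Subgroup.map_injective hf
    rw [Subgroup.map_inf _ _ _ hf, hmap, hmap, hmap, Set.image_inter Fin.val_injective,
      genSubgroup_inf_genSubgroup hadj hcomm (hval J) (hval K)]
  have hord' : ∀ i, orderOf (t i) = 2 := fun i => by
    rw [← orderOf_injective f hf, hfT, hord i i.2]
  refine ⟨fun i j hij => ?_, hord', ?_, fun i j h => ?_, hinf⟩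
  · by_contra hne
    have hmem : t i ∈ genSubgroup t {i} ⊓ genSubgroup t {j} :=
      ⟨mem_genSubgroup (Set.mem_singleton i), hij ▸ mem_genSubgroup (Set.mem_singleton j)⟩
    rw [hinf, Set.singleton_inter_eq_empty.2 (by simpa using hne),
      genSubgroup_empty, Subgroup.mem_bot] at hmem
    have := hord' i
    simp [hmem] at this
  · apply Subgroup.map_injective hf
    refine le_antisymm (Subgroup.map_mono le_top) ?_
    rw [← MonoidHom.range_eq_map, ← Set.image_univ]
    refine hgen.trans ((genSubgroup_mono ?_).trans (hmap Set.univ).ge)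
    exact fun i hi => ⟨⟨i, hi⟩, trivial, rfl⟩
  · apply hf
    rw [map_mul, map_mul, hfT, hfT, hcomm i j h]

end IsCString

/-! ### Signed permutations -/

section SignedPermutations

variable {α : Type*}

/-- The embedding of the permutations of `α` as the signed permutations without signs. -/
def diagHom (α : Type*) : Equiv.Perm α →* Equiv.Perm (α ⊕ α) :=
  (Equiv.Perm.sumCongrHom α α).comp ((MonoidHom.id _).prod (MonoidHom.id _))

@[simp]
theorem diagHom_apply_inl (σ : Equiv.Perm α) (i : α) :
    diagHom α σ (Sum.inl i) = Sum.inl (σ i) := rfl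

@[simp]
theorem diagHom_apply_inr (σ : Equiv.Perm α) (i : α) :
    diagHom α σ (Sum.inr i) = Sum.inr (σ i) := rfl

/-- The group of signed permutations of `α ⊕ α`, as the centralizer of `-1`. -/
def signedPerms (α : Type*) : Subgroup (Equiv.Perm (α ⊕ α)) :=
  Subgroup.centralizer {Equiv.sumComm α α}

theorem mem_signedPerms_iff {g : Equiv.Perm (α ⊕ α)} :
    g ∈ signedPerms α ↔ ∀ x, g x.swap = (g x).swap := by
  rw [signedPerms, Subgroup.mem_centralizer_singleton_iff, Equiv.ext_iff]
  rfl

theorem apply_inr_of_mem_signedPerms {g : Equiv.Perm (α ⊕ α)} (hg : g ∈ signedPerms α) (i : α) :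
    g (Sum.inr i) = (g (Sum.inl i)).swap :=
  mem_signedPerms_iff.1 hg (Sum.inl i)

theorem ext_of_mem_signedPerms {g h : Equiv.Perm (α ⊕ α)} (hg : g ∈ signedPerms α)
    (hh : h ∈ signedPerms α) (hgh : ∀ i, g (Sum.inl i) = h (Sum.inl i)) : g = h := by
  ext1 x
  rcases x with i | i
  · exact hgh i
  · rw [apply_inr_of_mem_signedPerms hg, hgh, apply_inr_of_mem_signedPerms hh]

theorem diagHom_mem_signedPerms (σ : Equiv.Perm α) : diagHom α σ ∈ signedPerms α := by
  rw [mem_signedPerms_iff]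
  rintro (i | i) <;> rfl

/-- The permutation changing the sign of the coordinates where `ε` is `-1`. -/
def signChange : (α → ℤˣ) →* Equiv.Perm (α ⊕ α) where
  toFun ε :=
    Function.Involutive.toPerm (fun x => if ε (Sum.elim id id x) = 1 then x else x.swap) fun x => by
      rcases x with i | i <;> by_cases h : ε i = 1 <;> simp [h]
  map_one' := by
    ext1 x
    simp [Function.Involutive.toPerm]
  map_mul' ε δ := by
    ext1 x
    rcases x with i | i <;> rcases Int.units_eq_one_or (ε i) with h | h <;>
      rcases Int.units_eq_one_or (δ i) with h' | h' <;> simp [Function.Involutive.toPerm, h, h']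

theorem signChange_apply (ε : α → ℤˣ) (x : α ⊕ α) :
    signChange ε x = if ε (Sum.elim id id x) = 1 then x else x.swap := rfl

theorem signChange_injective : Function.Injective (signChange (α := α)) :=
  (injective_iff_map_eq_one _).2 fun ε hε => funext fun i => by_contra fun hi => by
    simpa [signChange_apply, show ¬ε i = 1 from hi] using DFunLike.congr_fun hε (Sum.inl i)

theorem signChange_mem_signedPerms (ε : α → ℤˣ) : signChange ε ∈ signedPerms α := by
  rw [mem_signedPerms_iff]
  rintro (i | i) <;> by_cases h : ε i = 1 <;> simp [signChange_apply, h]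

theorem signChange_mul_self (ε : α → ℤˣ) : signChange ε * signChange ε = 1 := by
  rw [← map_mul, ← map_one signChange]
  exact congrArg signChange (funext fun i => Int.units_mul_self (ε i))

theorem signChange_neg_one : signChange (-1 : α → ℤˣ) = Equiv.sumComm α α := by
  ext1 x
  rw [signChange_apply, if_neg (by simp)]
  rfl

theorem diagHom_mul_signChange (σ : Equiv.Perm α) (ε : α → ℤˣ) :
    diagHom α σ * signChange ε = signChange (ε ∘ σ.symm) * diagHom α σ := by
  refine ext_of_mem_signedPerms (mul_mem (diagHom_mem_signedPerms _) (signChange_mem_signedPerms _))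
    (mul_mem (signChange_mem_signedPerms _) (diagHom_mem_signedPerms _)) fun i => ?_
  by_cases h : ε i = 1 <;> simp [signChange_apply, h]

/-- The permutation of the coordinates underlying a signed permutation. -/
def absPerm : signedPerms α →* Equiv.Perm α :=
  MonoidHom.toHomPerm
    { toFun := fun g i => Sum.elim id id (g.1 (Sum.inl i))
      map_one' := rfl
      map_mul' := fun g h => funext fun i => by
        change Sum.elim id id (g.1 (h.1 (Sum.inl i))) =
          Sum.elim id id (g.1 (Sum.inl (Sum.elim id id (h.1 (Sum.inl i)))))
        rcases h.1 (Sum.inl i) with j | j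
        · rfl
        · rw [apply_inr_of_mem_signedPerms g.2]
          rcases h' : g.1 (Sum.inl j) with k | k <;> simp [h'] }

theorem absPerm_apply (g : signedPerms α) (i : α) :
    absPerm g i = Sum.elim id id (g.1 (Sum.inl i)) := rfl

theorem absPerm_diagHom (σ : Equiv.Perm α) : absPerm ⟨diagHom α σ, diagHom_mem_signedPerms σ⟩ = σ :=
  rfl

theorem exists_eq_signChange_mul_diagHom {g : Equiv.Perm (α ⊕ α)} (hg : g ∈ signedPerms α) :
    ∃ ε, g = signChange ε * diagHom α (absPerm ⟨g, hg⟩) := by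
  set σ := absPerm ⟨g, hg⟩
  refine ⟨fun k => if (g (Sum.inl (σ.symm k))).isLeft then 1 else -1, ext_of_mem_signedPerms hg
    (mul_mem (signChange_mem_signedPerms _) (diagHom_mem_signedPerms _)) fun i => ?_⟩
  have hσi : σ i = Sum.elim id id (g (Sum.inl i)) := absPerm_apply ⟨g, hg⟩ i
  rcases hi : g (Sum.inl i) with j | j <;> rw [hi] at hσi <;>
    simp [signChange_apply, hi, ← show σ i = j from hσi]

variable [DecidableEq α]

/-- The sign change of the coordinate `i`. -/
def negAt (i : α) : Equiv.Perm (α ⊕ α) :=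
  signChange (Pi.mulSingle i (-1))

theorem negAt_mem_signedPerms (i : α) : negAt i ∈ signedPerms α :=
  signChange_mem_signedPerms _

theorem negAt_mul_self (i : α) : negAt i * negAt i = 1 :=
  signChange_mul_self _

theorem negAt_inv (i : α) : (negAt i)⁻¹ = negAt i :=
  inv_eq_of_mul_eq_one_right (negAt_mul_self i)

theorem negAt_commute (i j : α) : Commute (negAt i) (negAt j) := by
  rw [negAt, negAt, commute_iff_eq, ← map_mul, ← map_mul, mul_comm]

theorem negAt_eq_swap (i : α) : negAt i = Equiv.swap (Sum.inl i) (Sum.inr i) := by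
  ext1 x
  rcases x with j | j <;> by_cases h : j = i <;>
    simp [negAt, signChange_apply, Equiv.swap_apply_def, h]

theorem conj_negAt {g : Equiv.Perm (α ⊕ α)} (hg : g ∈ signedPerms α) (i : α) :
    g * negAt i * g⁻¹ = negAt (absPerm ⟨g, hg⟩ i) := by
  rw [negAt_eq_swap, ← Equiv.swap_apply_apply, apply_inr_of_mem_signedPerms hg, absPerm_apply,
    negAt_eq_swap]
  rcases g (Sum.inl i) with j | j
  · rfl
  · exact Equiv.swap_comm _ _

theorem signedPerms_le [Finite α] {H : Subgroup (Equiv.Perm (α ⊕ α))}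
    (hdiag : (diagHom α).range ≤ H) {i : α} (hi : negAt i ∈ H) : signedPerms α ≤ H := by
  have hneg : ∀ j, negAt j ∈ H := fun j => by
    have hconj := conj_negAt (diagHom_mem_signedPerms (Equiv.swap i j)) i
    rw [absPerm_diagHom, Equiv.swap_apply_left] at hconj
    rw [← hconj]
    exact mul_mem (mul_mem (hdiag ⟨_, rfl⟩) hi) (inv_mem (hdiag ⟨_, rfl⟩))
  have hsign : ∀ ε, ε ∈ H.comap signChange := fun ε => by
    have := Fintype.ofFinite α
    rw [← Finset.univ_prod_mulSingle ε]
    refine prod_mem fun j _ => ?_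
    rcases Int.units_eq_one_or (ε j) with h | h <;> rw [h]
    · rw [Pi.mulSingle_one]
      exact one_mem _
    · exact hneg j
  intro g hg
  obtain ⟨ε, hε⟩ := exists_eq_signChange_mul_diagHom hg
  rw [hε]
  exact mul_mem (hsign ε) (hdiag ⟨_, rfl⟩)

variable [Fintype α]

/-- The determinant of the matrix of a signed permutation. The second factor is the product of the
signs, because `diagHom` takes even values and each sign change is a transposition of `α ⊕ α`. -/
def signedDet : signedPerms α →* ℤˣ :=
  (Equiv.Perm.sign.comp absPerm) * (Equiv.Perm.sign.comp (signedPerms α).subtype)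

theorem signedDet_diagHom (σ : Equiv.Perm α) :
    signedDet ⟨diagHom α σ, diagHom_mem_signedPerms σ⟩ = Equiv.Perm.sign σ := by
  have hsign : Equiv.Perm.sign (diagHom α σ) = 1 :=
    (Equiv.Perm.sign_sumCongr σ σ).trans (Int.units_mul_self _)
  rw [signedDet, MonoidHom.mul_apply, MonoidHom.comp_apply, absPerm_diagHom, MonoidHom.comp_apply,
    Subgroup.subtype_apply, hsign, mul_one]

end SignedPermutations

section DSwap

variable {n : ℕ}

@[simp]
theorem dswap_apply_inl (a b i : Fin n) :
    dswap a b (Sum.inl i) = Sum.inl (Equiv.swap a b i) := by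
  rw [dswap, Equiv.Perm.mul_apply,
    Equiv.swap_apply_of_ne_of_ne (a := Sum.inr a) (b := Sum.inr b) (by simp) (by simp)]
  exact (Sum.inl_injective.map_swap a b i).symm

@[simp]
theorem dswap_apply_inr (a b i : Fin n) :
    dswap a b (Sum.inr i) = Sum.inr (Equiv.swap a b i) := by
  rw [dswap, Equiv.Perm.mul_apply, ← Sum.inr_injective.map_swap a b i]
  exact Equiv.swap_apply_of_ne_of_ne (by simp) (by simp)

theorem dswap_eq_diagHom (a b : Fin n) : dswap a b = diagHom (Fin n) (Equiv.swap a b) := by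
  ext1 x
  rcases x with x | x <;> simp

theorem dswap_mem_signedPerms (a b : Fin n) : dswap a b ∈ signedPerms (Fin n) := by
  rw [dswap_eq_diagHom]
  exact diagHom_mem_signedPerms _

@[simp]
theorem dswap_mul_self (a b : Fin n) : dswap a b * dswap a b = 1 := by
  rw [dswap_eq_diagHom, ← map_mul, Equiv.swap_mul_self, map_one]

theorem dswap_inv (a b : Fin n) : (dswap a b)⁻¹ = dswap a b :=
  inv_eq_of_mul_eq_one_right (dswap_mul_self a b)

theorem dswap_comm (a b : Fin n) : dswap a b = dswap b a := by
  rw [dswap_eq_diagHom, dswap_eq_diagHom, Equiv.swap_comm]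

theorem conj_diagHom_dswap (σ : Equiv.Perm (Fin n)) (a b : Fin n) :
    diagHom (Fin n) σ * dswap a b * (diagHom (Fin n) σ)⁻¹ = dswap (σ a) (σ b) := by
  rw [dswap_eq_diagHom, dswap_eq_diagHom, ← map_inv, ← map_mul, ← map_mul, Equiv.swap_apply_apply]

theorem dswap_mul_dswap_mul_dswap {a b c : Fin n} (hac : a ≠ c) (hbc : b ≠ c) :
    dswap a b * dswap b c * dswap a b = dswap a c := by
  have hconj := conj_diagHom_dswap (Equiv.swap a b) b c
  rwa [← dswap_eq_diagHom, dswap_inv, Equiv.swap_apply_right,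
    Equiv.swap_apply_of_ne_of_ne hac.symm hbc.symm] at hconj

theorem dswap_commute {a b c d : Fin n} (hac : a ≠ c) (had : a ≠ d) (hbc : b ≠ c) (hbd : b ≠ d) :
    Commute (dswap a b) (dswap c d) := by
  have hconj := conj_diagHom_dswap (Equiv.swap a b) c d
  rw [← dswap_eq_diagHom, Equiv.swap_apply_of_ne_of_ne hac.symm hbc.symm,
    Equiv.swap_apply_of_ne_of_ne had.symm hbd.symm] at hconj
  exact mul_inv_eq_iff_eq_mul.1 hconj

theorem signedDet_dswap {a b : Fin n} (hab : a ≠ b) :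
    signedDet ⟨dswap a b, dswap_mem_signedPerms a b⟩ = -1 := by
  rw [← Equiv.Perm.sign_swap hab, ← signedDet_diagHom]
  congr 2
  exact dswap_eq_diagHom a b

theorem negFrom_eq_signChange (k : ℕ) :
    negFrom n k = signChange fun i : Fin n => if k ≤ (i : ℕ) + 1 then -1 else 1 := by
  ext1 x
  rcases x with i | i <;> by_cases h : k ≤ (i : ℕ) + 1 <;> simp [negFrom, signChange_apply, h]

theorem negFrom_mem_signedPerms (k : ℕ) : negFrom n k ∈ signedPerms (Fin n) := by
  rw [negFrom_eq_signChange]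
  exact signChange_mem_signedPerms _

theorem negFrom_one : negFrom n 1 = Equiv.sumComm (Fin n) (Fin n) := by
  rw [negFrom_eq_signChange, ← signChange_neg_one]
  exact congrArg signChange (funext fun i => if_pos (by omega))

end DSwap

section SwapGeneration

theorem mem_of_forall_swap_mem {α : Type*} [DecidableEq α] [Finite α]
    {H : Subgroup (Equiv.Perm α)} {S : Set α} (hH : ∀ a ∈ S, ∀ b ∈ S, Equiv.swap a b ∈ H)
    {σ : Equiv.Perm α} (hσ : ∀ x ∉ S, σ x = x) : σ ∈ H := by
  have hmem : ∀ x, σ x ≠ x → x ∈ S := fun x hx => by_contra fun h => hx (hσ x h)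
  let swaps : Set (Equiv.Perm α) := {τ | τ.IsSwap ∧ τ ∈ H}
  suffices σ ∈ Subgroup.closure swaps from (Subgroup.closure_le H).2 (fun τ hτ => hτ.2) this
  rw [mem_closure_isSwap fun τ hτ => hτ.1]
  refine ⟨Set.toFinite _, fun x => ?_⟩
  by_cases hx : σ x = x
  · rw [hx]
    exact MulAction.mem_orbit_self x
  · have hswap := hH x (hmem x hx) (σ x) (hmem (σ x) fun h => hx (σ.injective h))
    exact ⟨⟨Equiv.swap x (σ x), Subgroup.subset_closure ⟨⟨x, σ x, Ne.symm hx, rfl⟩, hswap⟩⟩,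
      Equiv.swap_apply_left _ _⟩

theorem swap_mem_of_adjacent_swap_mem {n p q : ℕ} {H : Subgroup (Equiv.Perm (Fin n))}
    (hH : ∀ i (hi : i + 1 < n), p ≤ i → i < q →
      Equiv.swap (⟨i, by omega⟩ : Fin n) ⟨i + 1, hi⟩ ∈ H)
    {a b : Fin n} (ha : p ≤ a ∧ a ≤ q) (hb : p ≤ b ∧ b ≤ q) : Equiv.swap a b ∈ H := by
  wlog hab : a ≤ b generalizing a b
  · rw [Equiv.swap_comm]
    exact this hb ha (le_of_not_ge hab)
  obtain ⟨b, hbn⟩ := b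
  replace hab : (a : ℕ) ≤ b := hab
  replace hb : b ≤ q := hb.2
  induction b, hab using Nat.le_induction with
  | base =>
    rw [Fin.eta, Equiv.swap_self]
    exact H.one_mem
  | succ b hab ih =>
    exact SubmonoidClass.swap_mem_trans H (ih (by omega) (by omega))
      (hH b hbn (ha.1.trans hab) (by omega))

theorem mem_of_adjacent_swap_mem {n p q : ℕ} {H : Subgroup (Equiv.Perm (Fin n))}
    (hH : ∀ i (hi : i + 1 < n), p ≤ i → i < q →
      Equiv.swap (⟨i, by omega⟩ : Fin n) ⟨i + 1, hi⟩ ∈ H)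
    {σ : Equiv.Perm (Fin n)} (hσ : ∀ i : Fin n, (i : ℕ) < p ∨ q < i → σ i = i) : σ ∈ H :=
  mem_of_forall_swap_mem (S := {i : Fin n | p ≤ i ∧ i ≤ q})
    (fun _ ha _ hb => swap_mem_of_adjacent_swap_mem hH ha hb)
    fun i hi => hσ i (by rw [Set.mem_ofPred_eq] at hi; omega)

end SwapGeneration

/-! ### Coxeter groups of type `B` -/

section Involutions

variable {G : Type*} [Group G] {a b : G}

theorem mul_sq_eq_one_iff_commute (ha : a * a = 1) (hb : b * b = 1) :
    (a * b) ^ 2 = 1 ↔ Commute a b := by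
  rw [sq, mul_eq_one_iff_eq_inv, mul_inv_rev, inv_eq_of_mul_eq_one_right ha,
    inv_eq_of_mul_eq_one_right hb, commute_iff_eq]

theorem mul_pow_three_eq_one_iff (ha : a * a = 1) (hb : b * b = 1) :
    (a * b) ^ 3 = 1 ↔ a * b * a = b * a * b := by
  rw [show (a * b) ^ 3 = a * b * a * (b * a * b) by
    simp only [pow_succ, pow_zero, one_mul, mul_assoc], mul_eq_one_iff_eq_inv, mul_inv_rev,
    mul_inv_rev, inv_eq_of_mul_eq_one_right ha, inv_eq_of_mul_eq_one_right hb, mul_assoc b]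

theorem mul_pow_four_eq_one_iff (ha : a * a = 1) (hb : b * b = 1) :
    (a * b) ^ 4 = 1 ↔ a * b * a * b = b * a * b * a := by
  rw [show (a * b) ^ 4 = a * b * a * b * (a * b * a * b) by
    simp only [pow_succ, pow_zero, one_mul, mul_assoc], mul_eq_one_iff_eq_inv,
    mul_inv_rev, mul_inv_rev, mul_inv_rev, inv_eq_of_mul_eq_one_right ha,
    inv_eq_of_mul_eq_one_right hb, mul_assoc (b * a), mul_assoc b]

end Involutions

section TypeB

variable {G : Type*} [Group G]

/-- The relations between the simple reflections of a Coxeter group of type `B`, the node `0` being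
the end of the edge labelled `4`. The sequence `s` is constrained on the indices below `n` only. -/
structure TypeBRelations (s : ℕ → G) (n : ℕ) : Prop where
  sq : ∀ i < n, s i * s i = 1
  four : 1 < n → s 0 * s 1 * s 0 * s 1 = s 1 * s 0 * s 1 * s 0
  braid : ∀ i, 1 ≤ i → i + 1 < n → s i * s (i + 1) * s i = s (i + 1) * s i * s (i + 1)
  comm : ∀ i j, i + 2 ≤ j → j < n → s i * s j = s j * s i

theorem typeB_rev_rev {n i j : ℕ} (hij : i < j) (hj : j < n) :
    CoxeterMatrix.B n (Fin.rev ⟨i, hij.trans hj⟩) (Fin.rev ⟨j, hj⟩) =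
      if i + 2 ≤ j then 2 else if i = 0 then 4 else 3 := by
  change (if _ then 1 else if (_ ∧ _) ∨ _ then 4 else if _ ∨ _ then 3 else 2) = _
  simp only [Fin.ext_iff, Fin.val_rev]
  split_ifs <;> omega

theorem typeBRelations_of_isLiftable {s : ℕ → G} {n : ℕ}
    (h : (CoxeterMatrix.B n).IsLiftable fun i : Fin n => s i.rev) : TypeBRelations s n := by
  have hsq : ∀ i < n, s i * s i = 1 := fun i hi => by
    simpa [CoxeterMatrix.diagonal] using h (Fin.rev ⟨i, hi⟩) (Fin.rev ⟨i, hi⟩)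
  have hpow : ∀ i j, i < j → j < n →
      (s i * s j) ^ (if i + 2 ≤ j then 2 else if i = 0 then 4 else 3) = 1 := fun i j hij hj => by
    simpa only [typeB_rev_rev hij hj, Fin.rev_rev] using
      h (Fin.rev ⟨i, hij.trans hj⟩) (Fin.rev ⟨j, hj⟩)
  refine ⟨hsq, fun hn => ?_, fun i hi hin => ?_, fun i j hij hj => ?_⟩
  · exact (mul_pow_four_eq_one_iff (hsq 0 (by omega)) (hsq 1 hn)).1 (hpow 0 1 one_pos hn)
  · have hthree := hpow i (i + 1) (by omega) hin
    rw [if_neg (by omega), if_neg (by omega)] at hthree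
    exact (mul_pow_three_eq_one_iff (hsq i (by omega)) (hsq _ hin)).1 hthree
  · have htwo := hpow i j (by omega) hj
    rw [if_pos hij] at htwo
    exact (mul_sq_eq_one_iff_commute (hsq i (by omega)) (hsq j hj)).1 htwo

theorem TypeBRelations.isLiftable {s : ℕ → G} {n : ℕ} (h : TypeBRelations s n) :
    (CoxeterMatrix.B n).IsLiftable fun i : Fin n => s i.rev := by
  have hpow : ∀ i j, i < j → j < n →
      (s i * s j) ^ (if i + 2 ≤ j then 2 else if i = 0 then 4 else 3) = 1 := by
    intro i j hij hj
    have hi := h.sq i (hij.trans hj)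
    split_ifs with h2 h0
    · exact (mul_sq_eq_one_iff_commute hi (h.sq j hj)).2 (h.comm i j h2 hj)
    · obtain ⟨rfl, rfl⟩ : i = 0 ∧ j = 1 := by omega
      exact (mul_pow_four_eq_one_iff hi (h.sq 1 hj)).2 (h.four hj)
    · obtain rfl : j = i + 1 := by omega
      exact (mul_pow_three_eq_one_iff hi (h.sq _ hj)).2 (h.braid i (by omega) hj)
  intro i' j'
  obtain ⟨⟨i, hi⟩, rfl⟩ := Fin.rev_surjective i'
  obtain ⟨⟨j, hj⟩, rfl⟩ := Fin.rev_surjective j'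
  simp only [Fin.rev_rev]
  rcases lt_trichotomy i j with hij | rfl | hij
  · rw [typeB_rev_rev hij hj]
    exact hpow i j hij hj
  · rw [CoxeterMatrix.diagonal, pow_one]
    exact h.sq i hi
  · rw [CoxeterMatrix.symmetric, typeB_rev_rev hij hi, ← inv_eq_one, ← inv_pow,
      mul_inv_rev, inv_eq_of_mul_eq_one_right (h.sq i hi), inv_eq_of_mul_eq_one_right (h.sq j hj)]
    exact hpow j i hij hi

/-- The product `s i * s (i + 1) * ⋯ * s (i + l - 1)`. -/
def ascendingProd (s : ℕ → G) : ℕ → ℕ → G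
  | _, 0 => 1
  | i, l + 1 => s i * ascendingProd s (i + 1) l

/-- The product `s i * ⋯ * s 1 * s 0 * s 1 * ⋯ * s k`. -/
def valleyProd (s : ℕ → G) (k : ℕ) : ℕ → G
  | 0 => ascendingProd s 0 (k + 1)
  | i + 1 => s (i + 1) * valleyProd s k i

/-- `c` is one of the `2 * (k + 1)` representatives of the cosets of `⟨s 0, …, s (k - 1)⟩` in
`⟨s 0, …, s k⟩`, for `s` the simple reflections of a Coxeter group of type `B`. -/
def IsCosetRep (s : ℕ → G) (k : ℕ) (c : G) : Prop :=
  (∃ i l, i + l = k ∧ c = ascendingProd s (i + 1) l) ∨ ∃ i ≤ k, c = valleyProd s k i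

namespace TypeBRelations

variable {s : ℕ → G} {n : ℕ} (h : TypeBRelations s n)
include h

theorem mul_ascendingProd_of_lt (l i j : ℕ) (hj : j + 2 ≤ i) (hi : i + l ≤ n) :
    s j * ascendingProd s i l = ascendingProd s i l * s j := by
  induction l generalizing i with
  | zero => rw [ascendingProd, mul_one, one_mul]
  | succ l ih =>
    rw [ascendingProd, ← mul_assoc, h.comm j i hj (by omega), mul_assoc,
      ih (i + 1) (by omega) (by omega), mul_assoc]

theorem mul_ascendingProd_of_gt (l i j : ℕ) (hi : i < j) (hj : j < i + l) (hl : i + l ≤ n)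
    (hj2 : 2 ≤ j) : s j * ascendingProd s i l = ascendingProd s i l * s (j - 1) := by
  induction l generalizing i with
  | zero => omega
  | succ l ih =>
    rcases (show i + 1 ≤ j from hi).eq_or_lt with rfl | hij
    · obtain ⟨l, rfl⟩ := Nat.exists_eq_succ_of_ne_zero (show l ≠ 0 by omega)
      have hcomm := h.mul_ascendingProd_of_lt l (i + 2) i le_rfl (by omega)
      calc s (i + 1) * (s i * (s (i + 1) * ascendingProd s (i + 2) l))
          = s (i + 1) * s i * s (i + 1) * ascendingProd s (i + 2) l := by simp only [mul_assoc]
        _ = s i * s (i + 1) * s i * ascendingProd s (i + 2) l := by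
          rw [h.braid i (by omega) (by omega)]
        _ = s i * (s (i + 1) * ascendingProd s (i + 2) l) * s i := by
          simp only [mul_assoc, hcomm]
    · rw [ascendingProd, ← mul_assoc, ← h.comm i j hij (by omega), mul_assoc,
        ih (i + 1) hij (by omega) (by omega), mul_assoc]

theorem mul_valleyProd_of_gt (k i j : ℕ) (hij : i + 2 ≤ j) (hj : j ≤ k) (hk : k < n) :
    s j * valleyProd s k i = valleyProd s k i * s (j - 1) := by
  induction i with
  | zero => exact h.mul_ascendingProd_of_gt _ _ _ (by omega) (by omega) (by omega) (by omega)
  | succ i ih =>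
    rw [valleyProd, ← mul_assoc, ← h.comm (i + 1) j (by omega) (by omega), mul_assoc,
      ih (by omega), mul_assoc]

theorem mul_valleyProd_succ_self (k j : ℕ) (hj : j + 1 ≤ k) (hk : k < n) :
    s j * valleyProd s k (j + 1) = valleyProd s k (j + 1) * s j := by
  rcases j with _ | j
  · obtain ⟨k, rfl⟩ := Nat.exists_eq_succ_of_ne_zero (show k ≠ 0 by omega)
    have hcomm := h.mul_ascendingProd_of_lt k 2 0 le_rfl (by omega)
    calc s 0 * (s 1 * (s 0 * (s 1 * ascendingProd s 2 k)))
        = s 0 * s 1 * s 0 * s 1 * ascendingProd s 2 k := by simp only [mul_assoc]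
      _ = s 1 * s 0 * s 1 * s 0 * ascendingProd s 2 k := by rw [h.four (by omega)]
      _ = s 1 * (s 0 * (s 1 * ascendingProd s 2 k)) * s 0 := by simp only [mul_assoc, hcomm]
  · have hcomm := h.mul_valleyProd_of_gt k j (j + 2) le_rfl (by omega) hk
    rw [show j + 2 - 1 = j + 1 by omega] at hcomm
    calc s (j + 1) * (s (j + 2) * (s (j + 1) * valleyProd s k j))
        = s (j + 1) * s (j + 2) * s (j + 1) * valleyProd s k j := by simp only [mul_assoc]
      _ = s (j + 2) * s (j + 1) * s (j + 2) * valleyProd s k j := by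
        rw [h.braid (j + 1) (by omega) (by omega)]
      _ = s (j + 2) * (s (j + 1) * valleyProd s k j) * s (j + 1) := by
        simp only [mul_assoc, hcomm]

theorem mul_valleyProd_of_lt (k i j : ℕ) (hj : j < i) (hi : i ≤ k) (hk : k < n) :
    s j * valleyProd s k i = valleyProd s k i * s j := by
  induction i with
  | zero => omega
  | succ i ih =>
    rcases (show j ≤ i by omega).eq_or_lt with rfl | hij
    · exact h.mul_valleyProd_succ_self k j hi hk
    · rw [valleyProd, ← mul_assoc, h.comm j (i + 1) (by omega) (by omega), mul_assoc,
        ih hij (by omega), mul_assoc]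

theorem exists_mul_ascendingProd_eq {k i l j : ℕ} (hl : i + l = k) (hj : j ≤ k) (hk : k < n) :
    ∃ c, IsCosetRep s k c ∧ ∃ x ∈ genSubgroup s (Set.Iio k),
      s j * ascendingProd s (i + 1) l = c * x := by
  rcases lt_trichotomy j i with hji | rfl | hji
  · exact ⟨_, Or.inl ⟨i, l, hl, rfl⟩, s j, mem_genSubgroup (Set.mem_Iio.2 (by omega)),
      h.mul_ascendingProd_of_lt l (i + 1) j (by omega) (by omega)⟩
  · refine ⟨ascendingProd s j (l + 1), ?_, 1, one_mem _, by rw [mul_one, ascendingProd]⟩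
    rcases j with _ | j
    · exact Or.inr ⟨0, zero_le, by rw [valleyProd, ← hl, zero_add]⟩
    · exact Or.inl ⟨j, l + 1, by omega, rfl⟩
  · rcases (show i + 1 ≤ j from hji).eq_or_lt with rfl | hij
    · obtain ⟨l, rfl⟩ := Nat.exists_eq_succ_of_ne_zero (show l ≠ 0 by omega)
      refine ⟨_, Or.inl ⟨i + 1, l, by omega, rfl⟩, 1, one_mem _, ?_⟩
      rw [mul_one, ascendingProd, ← mul_assoc, h.sq _ (by omega), one_mul]
    · exact ⟨_, Or.inl ⟨i, l, hl, rfl⟩, s (j - 1), mem_genSubgroup (Set.mem_Iio.2 (by omega)),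
        h.mul_ascendingProd_of_gt l (i + 1) j hij (by omega) (by omega) (by omega)⟩

theorem exists_mul_valleyProd_eq {k i j : ℕ} (hi : i ≤ k) (hj : j ≤ k) (hk : k < n) :
    ∃ c, IsCosetRep s k c ∧ ∃ x ∈ genSubgroup s (Set.Iio k), s j * valleyProd s k i = c * x := by
  rcases lt_trichotomy j i with hji | rfl | hji
  · exact ⟨_, Or.inr ⟨i, hi, rfl⟩, s j, mem_genSubgroup (Set.mem_Iio.2 (by omega)),
      h.mul_valleyProd_of_lt k i j hji hi hk⟩
  · rcases j with _ | j
    · refine ⟨_, Or.inl ⟨0, k, zero_add k, rfl⟩, 1, one_mem _, ?_⟩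
      rw [mul_one, valleyProd, ascendingProd, ← mul_assoc, h.sq 0 (by omega), one_mul]
    · refine ⟨_, Or.inr ⟨j, by omega, rfl⟩, 1, one_mem _, ?_⟩
      rw [mul_one, valleyProd, ← mul_assoc, h.sq _ (by omega), one_mul]
  · rcases (show i + 1 ≤ j from hji).eq_or_lt with rfl | hij
    · exact ⟨_, Or.inr ⟨i + 1, hj, rfl⟩, 1, one_mem _, by rw [mul_one, valleyProd]⟩
    · exact ⟨_, Or.inr ⟨i, hi, rfl⟩, s (j - 1), mem_genSubgroup (Set.mem_Iio.2 (by omega)),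
        h.mul_valleyProd_of_gt k i j hij hj hk⟩

theorem exists_isCosetRep_mul {k : ℕ} (hk : k < n) {g : G}
    (hg : g ∈ genSubgroup s (Set.Iio (k + 1))) :
    ∃ c, IsCosetRep s k c ∧ ∃ x ∈ genSubgroup s (Set.Iio k), g = c * x := by
  refine closure_induction_of_mul_self_eq_one
    (p := fun g => ∃ c, IsCosetRep s k c ∧ ∃ x ∈ genSubgroup s (Set.Iio k), g = c * x) ?_ ?_ ?_ hg
  · rintro _ ⟨j, hj, rfl⟩
    rw [Set.mem_Iio] at hj
    exact h.sq j (by omega)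
  · exact ⟨1, Or.inl ⟨k, 0, rfl, rfl⟩, 1, one_mem _, (mul_one 1).symm⟩
  · rintro _ ⟨j, hj, rfl⟩ _ ⟨c, hc, x, hx, rfl⟩
    have hjk : j ≤ k := Nat.lt_succ_iff.1 hj
    have hstep : ∃ c', IsCosetRep s k c' ∧ ∃ y ∈ genSubgroup s (Set.Iio k), s j * c = c' * y := by
      obtain ⟨i, l, hl, rfl⟩ | ⟨i, hi, rfl⟩ := hc
      · exact h.exists_mul_ascendingProd_eq hl hjk hk
      · exact h.exists_mul_valleyProd_eq hi hjk hk
    obtain ⟨c', hc', y, hy, hcy⟩ := hstep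
    exact ⟨c', hc', y * x, mul_mem hy hx, by rw [← mul_assoc, hcy, mul_assoc]⟩

end TypeBRelations

end TypeB

section SignedRepresentation

variable {n : ℕ}

theorem betaPerm_of_zero (h : 0 < n) : betaPerm (⟨0, h⟩ : Fin n) = negAt ⟨0, h⟩ := by
  rw [negAt_eq_swap, betaPerm, dif_pos rfl]

theorem betaPerm_of_pos {j : ℕ} (h : j + 1 < n) :
    betaPerm (⟨j + 1, h⟩ : Fin n) = dswap ⟨j, by omega⟩ ⟨j + 1, h⟩ := by
  rw [betaPerm, dif_neg (Nat.succ_ne_zero j)]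
  rfl

theorem betaPerm_mem_signedPerms (j : Fin n) : betaPerm j ∈ signedPerms (Fin n) := by
  rcases j with ⟨_ | j, hj⟩
  · rw [betaPerm_of_zero]
    exact negAt_mem_signedPerms _
  · rw [betaPerm_of_pos]
    exact dswap_mem_signedPerms _ _

theorem betaPerm_mul_self (j : Fin n) : betaPerm j * betaPerm j = 1 := by
  rcases j with ⟨_ | j, hj⟩
  · rw [betaPerm_of_zero, negAt_mul_self]
  · rw [betaPerm_of_pos, dswap_mul_self]

theorem betaPerm_apply_inl_of_lt {i j : Fin n} (hji : j < i) :
    betaPerm j (Sum.inl i) = Sum.inl i := by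
  rw [Fin.lt_def] at hji
  rcases j with ⟨_ | j, hj⟩
  · rw [betaPerm_of_zero, negAt_eq_swap, Equiv.swap_apply_of_ne_of_ne]
    · simp only [ne_eq, Sum.inl.injEq, Fin.ext_iff]
      omega
    · exact Sum.inl_ne_inr
  · rw [betaPerm_of_pos, dswap_apply_inl, Equiv.swap_apply_of_ne_of_ne] <;>
      rw [Fin.ne_iff_vne] <;> dsimp only at hji ⊢ <;> omega

theorem betaPerm_four (h : 1 < n) :
    betaPerm (⟨0, by omega⟩ : Fin n) * betaPerm ⟨1, h⟩ * betaPerm ⟨0, by omega⟩ *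
        betaPerm ⟨1, h⟩ =
      betaPerm ⟨1, h⟩ * betaPerm ⟨0, by omega⟩ * betaPerm ⟨1, h⟩ * betaPerm ⟨0, by omega⟩ := by
  have hconj := conj_negAt (dswap_mem_signedPerms (⟨0, by omega⟩ : Fin n) ⟨0 + 1, h⟩)
    ⟨0, by omega⟩
  rw [dswap_inv, absPerm_apply, dswap_apply_inl, Equiv.swap_apply_left] at hconj
  rw [betaPerm_of_zero, betaPerm_of_pos, hconj, mul_assoc, mul_assoc, ← mul_assoc (dswap _ _),
    hconj]
  exact negAt_commute _ _

theorem betaPerm_braid {j : ℕ} (h : j + 2 < n) :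
    betaPerm (⟨j + 1, by omega⟩ : Fin n) * betaPerm ⟨j + 2, h⟩ * betaPerm ⟨j + 1, by omega⟩ =
      betaPerm ⟨j + 2, h⟩ * betaPerm ⟨j + 1, by omega⟩ * betaPerm ⟨j + 2, h⟩ := by
  rw [betaPerm_of_pos, betaPerm_of_pos, dswap_mul_dswap_mul_dswap, dswap_comm ⟨j + 1, _⟩,
    dswap_comm ⟨j, _⟩ ⟨j + 1, _⟩, dswap_mul_dswap_mul_dswap, dswap_comm] <;>
  · rw [Fin.ne_iff_vne]
    dsimp only
    omega

theorem betaPerm_commute {i j : ℕ} (hij : i + 2 ≤ j) (hj : j < n) :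
    Commute (betaPerm (⟨i, by omega⟩ : Fin n)) (betaPerm ⟨j, hj⟩) := by
  obtain ⟨j, rfl⟩ := Nat.exists_eq_succ_of_ne_zero (show j ≠ 0 by omega)
  rcases i with _ | i
  · have hconj := conj_negAt (dswap_mem_signedPerms (⟨j, by omega⟩ : Fin n) ⟨j + 1, hj⟩)
      ⟨0, by omega⟩
    rw [absPerm_apply, dswap_apply_inl, Equiv.swap_apply_of_ne_of_ne] at hconj
    · rw [betaPerm_of_zero, betaPerm_of_pos]
      exact (mul_inv_eq_iff_eq_mul.1 hconj).symm
    all_goals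
      rw [Fin.ne_iff_vne]
      dsimp only
      omega
  · rw [betaPerm_of_pos, betaPerm_of_pos]
    apply dswap_commute <;>
    · rw [Fin.ne_iff_vne]
      dsimp only
      omega

theorem typeBRelations_betaPerm (n : ℕ) :
    TypeBRelations (Function.extend Fin.val (betaPerm (n := n)) 1) n := by
  have hval : ∀ j (hj : j < n), Function.extend Fin.val betaPerm 1 j = betaPerm (⟨j, hj⟩ : Fin n) :=
    fun j hj => Fin.val_injective.extend_apply betaPerm 1 ⟨j, hj⟩
  constructor
  · intro i hi
    rw [hval i hi, betaPerm_mul_self]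
  · intro hn
    rw [hval 0 (by omega), hval 1 hn, betaPerm_four]
  · intro i hi hin
    obtain ⟨i, rfl⟩ := Nat.exists_eq_succ_of_ne_zero (show i ≠ 0 by omega)
    rw [hval _ (by omega), hval _ hin, betaPerm_braid]
  · intro i j hij hj
    rw [hval i (by omega), hval j hj, (betaPerm_commute hij hj).eq]

theorem isLiftable_betaPerm (n : ℕ) :
    (CoxeterMatrix.B n).IsLiftable fun i : Fin n => betaPerm i.rev := by
  convert (typeBRelations_betaPerm n).isLiftable with i
  exact (Fin.val_injective.extend_apply betaPerm 1 i.rev).symm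

/-- The representation of the Coxeter group of type `B` by signed permutations. -/
noncomputable def signedRep (n : ℕ) :
    (CoxeterMatrix.B n).Group →* Equiv.Perm (Fin n ⊕ Fin n) :=
  (CoxeterMatrix.B n).toCoxeterSystem.lift ⟨_, isLiftable_betaPerm n⟩

theorem signedRep_simple (j : Fin n) :
    signedRep n ((CoxeterMatrix.B n).simple j.rev) = betaPerm j := by
  have hlift := (CoxeterMatrix.B n).toCoxeterSystem.lift_apply_simple (isLiftable_betaPerm n) j.rev
  rwa [CoxeterMatrix.toCoxeterSystem_simple, Fin.rev_rev] at hlift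

theorem range_signedRep (hn : 0 < n) : (signedRep n).range = signedPerms (Fin n) := by
  apply le_antisymm
  · rw [MonoidHom.range_eq_map, ← (CoxeterMatrix.B n).toCoxeterSystem.subgroup_closure_range_simple,
      MonoidHom.map_closure, Subgroup.closure_le]
    rintro _ ⟨_, ⟨i, rfl⟩, rfl⟩
    rw [CoxeterMatrix.toCoxeterSystem_simple, ← Fin.rev_rev i, signedRep_simple]
    exact betaPerm_mem_signedPerms _
  · refine signedPerms_le (i := ⟨0, hn⟩) ?_ ⟨_, by rw [signedRep_simple, betaPerm_of_zero]⟩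
    rintro _ ⟨σ, rfl⟩
    refine mem_of_adjacent_swap_mem (H := (signedRep n).range.comap (diagHom (Fin n))) (p := 0)
      (q := n) (fun i hi _ _ => ?_) fun i hi => by have := i.2; omega
    rw [Subgroup.mem_comap, ← dswap_eq_diagHom, ← betaPerm_of_pos]
    exact ⟨_, signedRep_simple _⟩

section Faithful

variable {G : Type*} [Group G] {s : ℕ → G} {ρ : G →* Equiv.Perm (Fin n ⊕ Fin n)}
  (hρ : ∀ j (hj : j < n), ρ (s j) = betaPerm ⟨j, hj⟩)
include hρ

theorem map_ascendingProd_apply_inl {i l k : ℕ} (hl : i + l = k) (hk : k < n) :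
    ρ (ascendingProd s (i + 1) l) (Sum.inl ⟨k, hk⟩) = Sum.inl ⟨i, by omega⟩ := by
  induction l generalizing i with
  | zero =>
    obtain rfl : i = k := hl
    rw [ascendingProd, map_one, Equiv.Perm.one_apply]
  | succ l ih =>
    rw [ascendingProd, map_mul, Equiv.Perm.mul_apply, ih (by omega), hρ _ (by omega),
      betaPerm_of_pos, dswap_apply_inl, Equiv.swap_apply_right]

theorem map_valleyProd_apply_inl {i k : ℕ} (hi : i ≤ k) (hk : k < n) :
    ρ (valleyProd s k i) (Sum.inl ⟨k, hk⟩) = Sum.inr ⟨i, by omega⟩ := by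
  induction i with
  | zero =>
    rw [valleyProd, ascendingProd, map_mul, Equiv.Perm.mul_apply,
      map_ascendingProd_apply_inl hρ (zero_add k) hk, hρ 0 (by omega), betaPerm_of_zero,
      negAt_eq_swap, Equiv.swap_apply_left]
  | succ i ih =>
    rw [valleyProd, map_mul, Equiv.Perm.mul_apply, ih (by omega), hρ _ (by omega),
      betaPerm_of_pos, dswap_apply_inr, Equiv.swap_apply_left]

theorem map_apply_inl_of_mem_genSubgroup {k : ℕ} (hk : k < n) {x : G}
    (hx : x ∈ genSubgroup s (Set.Iio k)) : ρ x (Sum.inl ⟨k, hk⟩) = Sum.inl ⟨k, hk⟩ := by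
  have hle : genSubgroup s (Set.Iio k) ≤
      (MulAction.stabilizer _ (Sum.inl ⟨k, hk⟩ : Fin n ⊕ Fin n)).comap ρ := by
    refine genSubgroup_le.2 fun j hj => ?_
    rw [Set.mem_Iio] at hj
    rw [Subgroup.mem_comap, MulAction.mem_stabilizer_iff, Equiv.Perm.smul_def, hρ j (by omega)]
    exact betaPerm_apply_inl_of_lt hj
  exact hle hx

theorem TypeBRelations.eq_one_of_map_eq_one (h : TypeBRelations s n) {k : ℕ} (hk : k ≤ n) {g : G}
    (hg : g ∈ genSubgroup s (Set.Iio k)) (hg1 : ρ g = 1) : g = 1 := by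
  induction k generalizing g with
  | zero => simpa [genSubgroup] using hg
  | succ k ih =>
    obtain ⟨c, hc, x, hx, rfl⟩ := h.exists_isCosetRep_mul hk hg
    have hcfix : ρ c (Sum.inl ⟨k, hk⟩) = Sum.inl ⟨k, hk⟩ := by
      rw [map_mul] at hg1
      simpa only [Equiv.Perm.mul_apply, Equiv.Perm.one_apply,
        map_apply_inl_of_mem_genSubgroup hρ hk hx] using
        DFunLike.congr_fun hg1 (Sum.inl ⟨k, hk⟩)
    obtain ⟨i, l, hl, rfl⟩ | ⟨i, hi, rfl⟩ := hc
    · rw [map_ascendingProd_apply_inl hρ hl hk, Sum.inl.injEq, Fin.mk.injEq] at hcfix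
      obtain rfl : l = 0 := by omega
      rw [ascendingProd, one_mul] at hg1 ⊢
      exact ih (by omega) hx hg1
    · rw [map_valleyProd_apply_inl hρ hi hk] at hcfix
      exact (Sum.inr_ne_inl hcfix).elim

end Faithful

theorem signedRep_injective (n : ℕ) : Function.Injective (signedRep n) := by
  set cs := (CoxeterMatrix.B n).toCoxeterSystem
  let s : ℕ → (CoxeterMatrix.B n).Group := Function.extend Fin.val (fun j => cs.simple j.rev) 1
  have hs : ∀ j : Fin n, s j = cs.simple j.rev := fun j => Fin.val_injective.extend_apply _ 1 j
  have hlift : (CoxeterMatrix.B n).IsLiftable fun i : Fin n => s i.rev := fun i j => by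
    simp only [hs, Fin.rev_rev]
    exact cs.simple_mul_simple_pow i j
  have htop : genSubgroup s (Set.Iio n) = ⊤ := by
    rw [eq_top_iff, ← cs.subgroup_closure_range_simple, Subgroup.closure_le]
    rintro _ ⟨j, rfl⟩
    rw [← Fin.rev_rev j, ← hs]
    exact mem_genSubgroup j.rev.2
  refine (injective_iff_map_eq_one _).2 fun g hg =>
    (typeBRelations_of_isLiftable hlift).eq_one_of_map_eq_one (fun j hj => ?_) le_rfl
      (htop ▸ Subgroup.mem_top g) hg
  rw [hs ⟨j, hj⟩]
  exact signedRep_simple _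

end SignedRepresentation

/-! ### Signed permutations of seven coordinates and a sign -/

section Block

variable {k n : ℕ}

/-- The splitting of `{±1, …, ±n}` into `{±1, …, ±k}` and the rest. -/
def blockEquiv (h : k ≤ n) :
    (Fin k ⊕ Fin k) ⊕ (Fin (n - k) ⊕ Fin (n - k)) ≃ Fin n ⊕ Fin n :=
  let f : Fin k ⊕ Fin (n - k) ≃ Fin n := finSumFinEquiv.trans (finCongr (by omega))
  (Equiv.sumSumSumComm _ _ _ _).trans (Equiv.sumCongr f f)

/-- The permutation acting on `{±1, …, ±k}` as the first component, and as the sign given by the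
second component on the other coordinates. -/
def blockHom (h : k ≤ n) :
    Equiv.Perm (Fin k ⊕ Fin k) × ℤˣ →* Equiv.Perm (Fin n ⊕ Fin n) :=
  (blockEquiv h).permCongrHom.toMonoidHom.comp
    ((Equiv.Perm.sumCongrHom _ _).comp
      ((MonoidHom.id _).prodMap (signChange.comp (Pi.constMonoidHom (Fin (n - k)) ℤˣ))))

theorem blockHom_injective (h : k < n) : Function.Injective (blockHom h.le) := by
  have : NeZero (n - k) := ⟨by omega⟩
  exact (blockEquiv h.le).permCongrHom.injective.comp
    (Equiv.Perm.sumCongrHom_injective.comp (Function.injective_id.prodMap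
      (signChange_injective.comp Function.const_injective)))

theorem blockHom_swap (h : k ≤ n) (x y : Fin k ⊕ Fin k) :
    blockHom h (Equiv.swap x y, 1) =
      Equiv.swap (blockEquiv h (Sum.inl x)) (blockEquiv h (Sum.inl y)) := by
  change (blockEquiv h).permCongrHom (Equiv.Perm.sumCongr (Equiv.swap x y)
    (signChange (Pi.constMonoidHom (Fin (n - k)) ℤˣ 1))) = _
  rw [map_one, map_one, Equiv.Perm.sumCongr_swap_one]
  exact Equiv.symm_trans_swap_trans _ _ _

theorem blockHom_dswap (h : k ≤ n) (a b : Fin k) :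
    blockHom h (dswap a b, 1) = dswap (Fin.castLE h a) (Fin.castLE h b) := by
  rw [dswap, ← one_mul (1 : ℤˣ), ← Prod.mk_mul_mk, map_mul, blockHom_swap, blockHom_swap]
  rfl

theorem blockHom_negAt (h : k ≤ n) (i : Fin k) :
    blockHom h (negAt i, 1) = negAt (Fin.castLE h i) := by
  rw [negAt_eq_swap, blockHom_swap, negAt_eq_swap]
  rfl

theorem blockHom_negFrom (h : k ≤ n) {l : ℕ} (hl : l ≤ k + 1) :
    blockHom h (negFrom k l, -1) = negFrom n l := by
  ext1 x
  obtain ⟨x, rfl⟩ := (blockEquiv h).surjective x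
  rcases x with (i | i) | (i | i)
  · by_cases hi : l ≤ (i : ℕ) + 1 <;> simp [blockHom, blockEquiv, negFrom, hi]
  · by_cases hi : l ≤ (i : ℕ) + 1 <;> simp [blockHom, blockEquiv, negFrom, hi]
  · simp [blockHom, blockEquiv, negFrom, signChange_apply, show l ≤ k + i + 1 by omega]
  · simp [blockHom, blockEquiv, negFrom, signChange_apply, show l ≤ k + i + 1 by omega]

end Block

section BlockGenerators

/-- The restrictions of the first three generators, conjugated by the sign change of the fifth
coordinate, to the first seven coordinates, together with their signs on the other ones. -/
def blockGen : Fin 3 → Equiv.Perm (Fin 7 ⊕ Fin 7) × ℤˣ :=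
  ![(dswap 1 2 * dswap 3 4 * negFrom 7 4, -1),
    (dswap 0 1 * dswap 2 3 * dswap 4 5 * negFrom 7 5, -1),
    (dswap 1 2 * dswap 5 6, 1)]

/-- The factor of `blockGen 1` commuting with the permutations of the last three coordinates. -/
def blockPairSwap : Equiv.Perm (Fin 7 ⊕ Fin 7) × ℤˣ :=
  (dswap 0 1 * dswap 2 3 * negFrom 7 5, -1)

theorem blockGen_injective : Function.Injective blockGen := by
  have : ∀ i j, blockGen i = blockGen j → i = j := by decide +kernel
  exact fun i j h => this i j h

theorem blockGen_mul_self (i : Fin 3) : blockGen i * blockGen i = 1 := by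
  revert i
  decide +kernel

/-- The signed permutations of determinant `1`. -/
def specialSignedPerms (α : Type*) [Fintype α] [DecidableEq α] :
    Subgroup (Equiv.Perm (α ⊕ α)) :=
  signedDet.ker.map (signedPerms α).subtype

theorem mem_specialSignedPerms_iff {α : Type*} [Fintype α] [DecidableEq α]
    {g : Equiv.Perm (α ⊕ α)} (hg : g ∈ signedPerms α) :
    g ∈ specialSignedPerms α ↔ signedDet ⟨g, hg⟩ = 1 := by
  simp [specialSignedPerms, hg, MonoidHom.mem_ker]

theorem dswap_notMem_specialSignedPerms {n : ℕ} {a b : Fin n} (hab : a ≠ b) :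
    dswap a b ∉ specialSignedPerms (Fin n) := by
  rw [mem_specialSignedPerms_iff (dswap_mem_signedPerms a b), signedDet_dswap hab]
  decide

theorem blockGen_fst_mem_signedPerms (i : Fin 3) : (blockGen i).1 ∈ signedPerms (Fin 7) :=
  mem_signedPerms_iff.2 (by revert i; decide +kernel)

theorem blockGen_fst_mem_specialSignedPerms (i : Fin 3) :
    (blockGen i).1 ∈ specialSignedPerms (Fin 7) := by
  rw [mem_specialSignedPerms_iff (blockGen_fst_mem_signedPerms i)]
  revert i
  decide +kernel

end BlockGenerators

section InvolutionPairs

variable {G : Type*} [Group G] {a b d r x : G}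

theorem exists_fin_pow_eq_of_mem_zpowers {N : ℕ} [NeZero N] (hr : r ^ N = 1)
    (hx : x ∈ Subgroup.zpowers r) : ∃ l : Fin N, r ^ (l : ℕ) = x := by
  obtain ⟨k, rfl⟩ := hx
  have hN : (N : ℤ) ≠ 0 := Int.natCast_ne_zero.2 (NeZero.ne N)
  have hk : ((k % N).toNat : ℤ) = k % N := Int.toNat_of_nonneg (Int.emod_nonneg k hN)
  refine ⟨⟨(k % N).toNat, by have := Int.emod_lt_of_pos k (b := N); omega⟩, ?_⟩
  change r ^ (k % N).toNat = r ^ k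
  rw [zpow_eq_zpow_emod' k hr, ← hk, zpow_natCast, Int.toNat_natCast]

theorem eq_one_or_eq_of_mem_zpowers (hr : r * r = 1) (hx : x ∈ Subgroup.zpowers r) :
    x = 1 ∨ x = r := by
  obtain ⟨l, rfl⟩ := exists_fin_pow_eq_of_mem_zpowers (N := 2) (by rw [sq, hr]) hx
  fin_cases l
  · exact Or.inl (pow_zero r)
  · exact Or.inr (pow_one r)

theorem mem_normalizer_closure {T : Set G} (hd : d * d = 1)
    (hT : ∀ t ∈ T, d * t * d⁻¹ ∈ Subgroup.closure T) :
    d ∈ Subgroup.normalizer (Subgroup.closure T : Set G) := by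
  have hconj : Subgroup.closure T ≤ (Subgroup.closure T).comap (MulAut.conj d).toMonoidHom :=
    (Subgroup.closure_le _).2 hT
  refine Subgroup.mem_normalizer_iff.2 fun x => ⟨fun hx => hconj hx, fun hx => ?_⟩
  have hback : d * (d * x * d⁻¹) * d⁻¹ ∈ Subgroup.closure T := hconj hx
  rwa [mul_assoc d x, ← mul_assoc d d, hd, one_mul, mul_assoc, ← mul_inv_rev, hd, inv_one,
    mul_one] at hback

theorem exists_mul_eq_of_mem_closure_pair (ha : a * a = 1) (hb : b * b = 1)
    (hx : x ∈ Subgroup.closure {a, b}) :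
    ∃ y ∈ Subgroup.zpowers (a * b), ∃ z ∈ Subgroup.zpowers a, y * z = x := by
  have hnorm : Subgroup.zpowers a ≤ Subgroup.normalizer (Subgroup.zpowers (a * b) : Set G) := by
    rw [Subgroup.zpowers_le, Subgroup.zpowers_eq_closure]
    refine mem_normalizer_closure ha ?_
    rintro _ rfl
    have hconj : a * (a * b) * a⁻¹ = (a * b)⁻¹ := by
      rw [← mul_assoc, ha, one_mul, mul_inv_rev, inv_eq_of_mul_eq_one_right hb]
    rw [hconj]
    exact inv_mem (Subgroup.subset_closure rfl)
  have hle : Subgroup.closure {a, b} ≤ Subgroup.zpowers (a * b) ⊔ Subgroup.zpowers a := by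
    have ha' := Subgroup.mem_sup_right (S := Subgroup.zpowers (a * b))
      (Subgroup.mem_zpowers a)
    rw [Subgroup.closure_le, Set.insert_subset_iff, Set.singleton_subset_iff]
    exact ⟨ha', (Subgroup.mul_mem_cancel_left _ ha').1
      (Subgroup.mem_sup_left (Subgroup.mem_zpowers (a * b)))⟩
  have hmul := hle hx
  rw [← SetLike.mem_coe, Subgroup.coe_mul_of_right_le_normalizer_left _ _ hnorm] at hmul
  exact Set.mem_mul.1 hmul

end InvolutionPairs

section BlockGenerators

theorem genSubgroup_blockGen_inf :
    genSubgroup blockGen {0, 1} ⊓ genSubgroup blockGen {1, 2} ≤ genSubgroup blockGen {1} := by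
  have hsq : ∀ i, blockGen i ^ 2 = 1 := fun i => by rw [sq, blockGen_mul_self]
  have key : ∀ (l l' : Fin 12) (i i' : Fin 2),
      (blockGen 0 * blockGen 1) ^ (l : ℕ) * blockGen 0 ^ (i : ℕ) =
        (blockGen 1 * blockGen 2) ^ (l' : ℕ) * blockGen 1 ^ (i' : ℕ) →
      (blockGen 1 * blockGen 2) ^ (l' : ℕ) * blockGen 1 ^ (i' : ℕ) = 1 ∨
        (blockGen 1 * blockGen 2) ^ (l' : ℕ) * blockGen 1 ^ (i' : ℕ) = blockGen 1 := by
    decide +kernel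
  rintro g ⟨h01, h12⟩
  rw [genSubgroup, Set.image_pair, SetLike.mem_coe] at h01 h12
  obtain ⟨y, hy, z, hz, rfl⟩ :=
    exists_mul_eq_of_mem_closure_pair (blockGen_mul_self 0) (blockGen_mul_self 1) h01
  obtain ⟨y', hy', z', hz', heq⟩ :=
    exists_mul_eq_of_mem_closure_pair (blockGen_mul_self 1) (blockGen_mul_self 2) h12
  obtain ⟨l, rfl⟩ := exists_fin_pow_eq_of_mem_zpowers (N := 12) (by decide +kernel) hy
  obtain ⟨l', rfl⟩ := exists_fin_pow_eq_of_mem_zpowers (N := 12) (by decide +kernel) hy'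
  obtain ⟨i, rfl⟩ := exists_fin_pow_eq_of_mem_zpowers (hsq 0) hz
  obtain ⟨i', rfl⟩ := exists_fin_pow_eq_of_mem_zpowers (hsq 1) hz'
  rw [← heq]
  rcases key l l' i i' heq.symm with h | h <;> rw [h]
  · exact one_mem _
  · exact mem_genSubgroup rfl

theorem blockGen_word : (blockGen 1 * blockGen 2 * blockGen 0) ^ 4 *
    (blockGen 1 * blockGen 0) ^ 2 * (blockGen 1 * blockGen 2 * blockGen 0) ^ 3 *
    blockGen 1 * blockGen 0 * blockGen 1 = (dswap 1 2, 1) * (negFrom 7 1, -1) := by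
  decide +kernel

theorem conj_mem_genSubgroup_blockGen (i : Fin 3) (hi : i ∈ ({1, 2} : Set (Fin 3))) :
    (dswap 4 5, 1) * blockGen i * (dswap 4 5, 1)⁻¹ ∈ genSubgroup blockGen {1, 2} := by
  have hmem : ∀ j ∈ ({1, 2} : Set (Fin 3)), blockGen j ∈ genSubgroup blockGen {1, 2} :=
    fun _ => mem_genSubgroup
  have hpow : (blockGen 1 * blockGen 2) ^ 4 ∈ genSubgroup blockGen {1, 2} :=
    pow_mem (mul_mem (hmem 1 (by simp)) (hmem 2 (by simp))) 4
  rcases hi with rfl | rfl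
  · rw [show (dswap 4 5, 1) * blockGen 1 * (dswap 4 5, 1)⁻¹ = blockGen 1 by decide +kernel]
    exact hmem 1 (by simp)
  · rw [show (dswap 4 5, 1) * blockGen 2 * (dswap 4 5, 1)⁻¹ =
      (blockGen 1 * blockGen 2) ^ 4 * blockGen 2 * ((blockGen 1 * blockGen 2) ^ 4)⁻¹ by
      decide +kernel]
    exact mul_mem (mul_mem hpow (hmem 2 (by simp))) (inv_mem hpow)

/-- The group `⟨(1 2)(3 4) ∏_{i ≥ 5} (-1)_i, (2 3)⟩ × Sym {5, 6, 7}`. -/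
def blockTail : Subgroup (Equiv.Perm (Fin 7 ⊕ Fin 7) × ℤˣ) :=
  Subgroup.closure {blockPairSwap, (dswap 1 2, 1), (dswap 4 5, 1), (dswap 5 6, 1)}

theorem blockTail_le :
    blockTail ≤ Subgroup.zpowers (dswap 4 5, 1) ⊔ genSubgroup blockGen {1, 2} := by
  have h1 : blockGen 1 ∈ genSubgroup blockGen {1, 2} := mem_genSubgroup (by simp)
  have h2 : blockGen 2 ∈ genSubgroup blockGen {1, 2} := mem_genSubgroup (by simp)
  have hpow : (blockGen 1 * blockGen 2) ^ 4 ∈ genSubgroup blockGen {1, 2} :=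
    pow_mem (mul_mem h1 h2) 4
  have hd : (dswap 4 5, 1) ∈ Subgroup.zpowers
      ((dswap 4 5, 1) : Equiv.Perm (Fin 7 ⊕ Fin 7) × ℤˣ) := Subgroup.mem_zpowers _
  rw [blockTail, Subgroup.closure_le]
  rintro _ (rfl | rfl | rfl | rfl)
  · rw [show blockPairSwap = (dswap 4 5, 1) * blockGen 1 by decide +kernel]
    exact Subgroup.mul_mem_sup hd h1
  · rw [show ((dswap 1 2, 1) : Equiv.Perm (Fin 7 ⊕ Fin 7) × ℤˣ) =
      (dswap 4 5, 1) * ((blockGen 1 * blockGen 2) ^ 4 * blockGen 2) by decide +kernel]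
    exact Subgroup.mul_mem_sup hd (mul_mem hpow h2)
  · exact Subgroup.mem_sup_left hd
  · rw [show ((dswap 5 6, 1) : Equiv.Perm (Fin 7 ⊕ Fin 7) × ℤˣ) =
      (dswap 4 5, 1) * (blockGen 1 * blockGen 2) ^ 4 by decide +kernel]
    exact Subgroup.mul_mem_sup hd hpow

theorem mem_or_mul_mem_of_mem_blockTail {q : Equiv.Perm (Fin 7 ⊕ Fin 7) × ℤˣ}
    (hq : q ∈ blockTail) :
    q ∈ genSubgroup blockGen {1, 2} ∨ (dswap 4 5, 1) * q ∈ genSubgroup blockGen {1, 2} := by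
  have hd : ((dswap 4 5, 1) * (dswap 4 5, 1) : Equiv.Perm (Fin 7 ⊕ Fin 7) × ℤˣ) = 1 := by
    decide +kernel
  have hnorm : Subgroup.zpowers (dswap 4 5, 1) ≤ Subgroup.normalizer
      (genSubgroup blockGen {1, 2} : Set (Equiv.Perm (Fin 7 ⊕ Fin 7) × ℤˣ)) := by
    refine (Subgroup.zpowers_le).2 (mem_normalizer_closure hd ?_)
    rintro _ ⟨i, hi, rfl⟩
    exact conj_mem_genSubgroup_blockGen i hi
  have hmul := blockTail_le hq
  rw [← SetLike.mem_coe, Subgroup.coe_mul_of_left_le_normalizer_right _ _ hnorm] at hmul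
  obtain ⟨c, hc, b, hb, rfl⟩ := Set.mem_mul.1 hmul
  rcases eq_one_or_eq_of_mem_zpowers hd hc with rfl | rfl
  · exact Or.inl (by rwa [one_mul])
  · exact Or.inr (by rwa [← mul_assoc, hd, one_mul])

theorem dswap_mem_of_blockGen_mem {H : Subgroup (Equiv.Perm (Fin 7 ⊕ Fin 7) × ℤˣ)}
    (h0 : blockGen 0 ∈ H) (hX : blockPairSwap ∈ H) (h12 : (dswap 1 2, 1) ∈ H)
    (h45 : (dswap 4 5, 1) ∈ H) :
    (dswap 3 4, 1) ∈ H ∧ (dswap 0 1, 1) ∈ H ∧ (dswap 2 3, 1) ∈ H ∧ (negAt 3, 1) ∈ H := by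
  have hconj : ∀ {g x}, g ∈ H → x ∈ H → g * x * g⁻¹ ∈ H :=
    fun hg hx => mul_mem (mul_mem hg hx) (inv_mem hg)
  have hq : (dswap 1 2, 1) * blockGen 0 ∈ H := mul_mem h12 h0
  have h35 : (dswap 3 5, 1) ∈ H := by
    rw [show ((dswap 3 5, 1) : Equiv.Perm (Fin 7 ⊕ Fin 7) × ℤˣ) = (dswap 1 2, 1) * blockGen 0 *
      ((dswap 4 5, 1) * ((dswap 1 2, 1) * blockGen 0) * (dswap 4 5, 1)⁻¹)⁻¹ * (dswap 4 5, 1) by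
      decide +kernel]
    exact mul_mem (mul_mem hq (inv_mem (hconj h45 hq))) h45
  have h34 : (dswap 3 4, 1) ∈ H := by
    rw [show ((dswap 3 4, 1) : Equiv.Perm (Fin 7 ⊕ Fin 7) × ℤˣ) =
      (dswap 4 5, 1) * (dswap 3 5, 1) * (dswap 4 5, 1)⁻¹ by decide +kernel]
    exact hconj h45 h35
  have h04 : (dswap 0 4, 1) ∈ H := by
    rw [show ((dswap 0 4, 1) : Equiv.Perm (Fin 7 ⊕ Fin 7) × ℤˣ) = (dswap 3 4, 1) *
      (blockPairSwap * (dswap 1 2, 1) * blockPairSwap⁻¹) * (dswap 3 4, 1)⁻¹ by decide +kernel]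
    exact hconj h34 (hconj hX h12)
  have hZ : blockPairSwap * ((dswap 3 4, 1) * ((dswap 1 2, 1) * blockGen 0)) ∈ H :=
    mul_mem hX (mul_mem h34 hq)
  have h01 : (dswap 0 1, 1) ∈ H := by
    rw [show ((dswap 0 1, 1) : Equiv.Perm (Fin 7 ⊕ Fin 7) × ℤˣ) = (dswap 0 4, 1) *
      (blockPairSwap * ((dswap 3 4, 1) * ((dswap 1 2, 1) * blockGen 0)) * (dswap 0 4, 1) *
        (blockPairSwap * ((dswap 3 4, 1) * ((dswap 1 2, 1) * blockGen 0)))⁻¹) *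
      (dswap 0 4, 1)⁻¹ by decide +kernel]
    exact hconj h04 (hconj hZ h04)
  have h23 : (dswap 2 3, 1) ∈ H := by
    rw [show ((dswap 2 3, 1) : Equiv.Perm (Fin 7 ⊕ Fin 7) × ℤˣ) = (dswap 3 4, 1) *
      ((dswap 0 4, 1) * ((dswap 0 1, 1) * (dswap 1 2, 1) * (dswap 0 1, 1)⁻¹) *
        (dswap 0 4, 1)⁻¹) * (dswap 3 4, 1)⁻¹ by decide +kernel]
    exact hconj h34 (hconj h04 (hconj h01 h12))
  refine ⟨h34, h01, h23, ?_⟩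
  rw [show ((negAt 3, 1) : Equiv.Perm (Fin 7 ⊕ Fin 7) × ℤˣ) = (dswap 0 1, 1) * (dswap 2 3, 1) *
    (blockPairSwap * ((dswap 3 4, 1) * ((dswap 1 2, 1) * blockGen 0))) by decide +kernel]
  exact mul_mem (mul_mem h01 h23) hZ

end BlockGenerators

/-! ### The subgroups generated by consecutive generators -/

section Commutation

variable {n k : ℕ} {a b i : Fin n}

theorem dswap_commute_negAt (ha : i ≠ a) (hb : i ≠ b) : Commute (dswap a b) (negAt i) := by
  have hconj := conj_negAt (dswap_mem_signedPerms a b) i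
  rw [absPerm_apply, dswap_apply_inl, Sum.elim_inl, Equiv.swap_apply_of_ne_of_ne ha hb] at hconj
  exact mul_inv_eq_iff_eq_mul.1 hconj

theorem negFrom_commute_negAt (k : ℕ) (i : Fin n) : Commute (negFrom n k) (negAt i) := by
  rw [negFrom_eq_signChange]
  exact (Commute.all _ _).map signChange

theorem negFrom_commute_dswap (ha : k ≤ a + 1) (hb : k ≤ b + 1) :
    Commute (negFrom n k) (dswap a b) := by
  rw [dswap_eq_diagHom, negFrom_eq_signChange, commute_iff_eq, diagHom_mul_signChange,
    Equiv.symm_swap]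
  congr 2
  ext1 i
  simp only [Function.comp_apply, Equiv.swap_apply_def]
  split_ifs <;> simp_all

theorem dswap_mul_dswap_pow_three {a b c : Fin n} (hab : a ≠ b) (hac : a ≠ c) (hbc : b ≠ c) :
    (dswap a b * dswap b c) ^ 3 = 1 := by
  rw [mul_pow_three_eq_one_iff (dswap_mul_self a b) (dswap_mul_self b c),
    dswap_mul_dswap_mul_dswap hac hbc, dswap_comm b c, dswap_comm a b,
    dswap_mul_dswap_mul_dswap hac.symm hab.symm, dswap_comm]

theorem mul_mul_pow_three {G : Type*} [Group G] {x a b : G} (hx : x * x = 1)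
    (hab : (a * b) ^ 3 = 1) (hc : Commute x (a * b)) : (x * a * b) ^ 3 = x := by
  rw [mul_assoc, hc.mul_pow, hab, mul_one, pow_succ, sq, hx, one_mul]

end Commutation

section IntervalPerms

variable {n p q : ℕ}

/-- The permutations of the coordinates `p + 1, …, q + 1`, as signed permutations. -/
def intervalPerms (n p q : ℕ) : Subgroup (Equiv.Perm (Fin n ⊕ Fin n)) :=
  (fixingSubgroup (Equiv.Perm (Fin n)) {i : Fin n | (i : ℕ) < p ∨ q < i}).map (diagHom (Fin n))

theorem intervalPerms_le {H : Subgroup (Equiv.Perm (Fin n ⊕ Fin n))}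
    (hH : ∀ i (hi : i + 1 < n), p ≤ i → i < q → dswap ⟨i, by omega⟩ ⟨i + 1, hi⟩ ∈ H) :
    intervalPerms n p q ≤ H := by
  rw [intervalPerms, Subgroup.map_le_iff_le_comap]
  refine fun σ hσ => mem_of_adjacent_swap_mem (fun i hi hp hq => ?_)
    ((mem_fixingSubgroup_iff (Equiv.Perm (Fin n))).1 hσ)
  rw [Subgroup.mem_comap, ← dswap_eq_diagHom]
  exact hH i hi hp hq

theorem dswap_mem_intervalPerms {i : ℕ} (hi : i + 1 < n) (hp : p ≤ i) (hq : i < q) :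
    dswap ⟨i, by omega⟩ ⟨i + 1, hi⟩ ∈ intervalPerms n p q := by
  rw [dswap_eq_diagHom]
  refine Subgroup.mem_map_of_mem _ ((mem_fixingSubgroup_iff _).2 fun j hj => ?_)
  refine Equiv.swap_apply_of_ne_of_ne ?_ ?_ <;> rintro rfl <;>
    simp only [Set.mem_ofPred_eq] at hj <;> omega

theorem intervalPerms_mono {p' q' : ℕ} (hp : p' ≤ p) (hq : q ≤ q') :
    intervalPerms n p q ≤ intervalPerms n p' q' :=
  intervalPerms_le fun _ hi hpi hiq =>
    dswap_mem_intervalPerms hi (hp.trans hpi) (hiq.trans_le hq)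

theorem mem_intervalPerms_of_commute_negAt (hq : q + 1 < n) {g : Equiv.Perm (Fin n ⊕ Fin n)}
    (hg : g ∈ intervalPerms n p (q + 1)) (hc : Commute g (negAt ⟨q + 1, hq⟩)) :
    g ∈ intervalPerms n p q := by
  obtain ⟨σ, hσ, rfl⟩ := hg
  have hfix : σ ⟨q + 1, hq⟩ = ⟨q + 1, hq⟩ := by
    have hconj := conj_negAt (diagHom_mem_signedPerms σ) ⟨q + 1, hq⟩
    rw [hc.eq, mul_inv_cancel_right, absPerm_diagHom, negAt_eq_swap, negAt_eq_swap] at hconj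
    by_contra hne
    simpa [Equiv.swap_apply_of_ne_of_ne, hne] using
      Equiv.congr_fun hconj (Sum.inl (σ ⟨q + 1, hq⟩))
  refine Subgroup.mem_map_of_mem _ ((mem_fixingSubgroup_iff _).2 fun i hi => ?_)
  rcases eq_or_ne i ⟨q + 1, hq⟩ with rfl | hne
  · exact hfix
  · refine (mem_fixingSubgroup_iff _).1 hσ i ?_
    simp only [Set.mem_ofPred_eq, ne_eq, Fin.ext_iff] at hi hne ⊢
    omega

end IntervalPerms

section TwistedGenerators

/-- The coordinate `i + 1`, for `i < 8`. -/
def coord {n : ℕ} (hn : 8 ≤ n) (i : ℕ) (hi : i < 8 := by omega) : Fin n := ⟨i, by omega⟩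

/-- The generator `t_{i+1}`, conjugated by the sign change of the fifth coordinate. It is trivial
for `i` out of range. -/
def twistedGen {n : ℕ} (hn : 8 ≤ n) (i : ℕ) : Equiv.Perm (Fin n ⊕ Fin n) :=
  if h : i < 3 then blockHom (k := 7) (by omega) (blockGen ⟨i, h⟩)
  else if h : i + 4 < n then dswap ⟨i + 3, by omega⟩ ⟨i + 4, h⟩ else 1

/-- The subgroup generated by the generators with numbers from `a` to `b - 1`. -/
abbrev genSpan {n : ℕ} (hn : 8 ≤ n) (a b : ℕ) : Subgroup (Equiv.Perm (Fin n ⊕ Fin n)) :=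
  genSubgroup (twistedGen hn) (Set.Ico a b)

/-- The element `(1 2)(3 4) ∏_{i ≥ 5} (-1)_i`, in the same notation as `blockTail`. -/
def pairSwap {n : ℕ} (hn : 8 ≤ n) : Equiv.Perm (Fin n ⊕ Fin n) :=
  dswap (coord hn 0) (coord hn 1) * dswap (coord hn 2) (coord hn 3) * negFrom n 5

variable {n : ℕ} (hn : 8 ≤ n)

theorem twistedGen_block {i : ℕ} (h : i < 3) :
    twistedGen hn i = blockHom (k := 7) (by omega) (blockGen ⟨i, h⟩) := dif_pos h

theorem twistedGen_of_ge {i : ℕ} (h : 3 ≤ i) (hi : i + 4 < n) :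
    twistedGen hn i = dswap ⟨i + 3, by omega⟩ ⟨i + 4, hi⟩ := by
  rw [twistedGen, dif_neg (by omega), dif_pos hi]

theorem twistedGen_eq_one {i : ℕ} (hi : n ≤ i + 4) : twistedGen hn i = 1 := by
  rw [twistedGen, dif_neg (by omega), dif_neg (by omega)]

theorem blockHom_blockPairSwap (h : 7 ≤ n) : blockHom h blockPairSwap = pairSwap hn := by
  rw [show blockPairSwap = (dswap 0 1, 1) * (dswap 2 3, 1) * (negFrom 7 5, -1) from rfl,
    map_mul, map_mul, blockHom_dswap, blockHom_dswap, blockHom_negFrom h (by norm_num)]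
  rfl

theorem twistedGen_zero : twistedGen hn 0 =
    dswap (coord hn 1) (coord hn 2) * dswap (coord hn 3) (coord hn 4) * negFrom n 4 := by
  rw [twistedGen_block hn (by norm_num),
    show blockGen ⟨0, by norm_num⟩ = (dswap 1 2, 1) * (dswap 3 4, 1) * (negFrom 7 4, -1) from rfl,
    map_mul, map_mul, blockHom_dswap, blockHom_dswap, blockHom_negFrom _ (by norm_num)]
  rfl

theorem twistedGen_one : twistedGen hn 1 = pairSwap hn * dswap (coord hn 4) (coord hn 5) := by
  rw [twistedGen_block hn (by norm_num),
    show blockGen ⟨1, by norm_num⟩ = blockPairSwap * (dswap 4 5, 1) by decide +kernel, map_mul,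
    blockHom_dswap, blockHom_blockPairSwap hn]
  rfl

theorem twistedGen_two :
    twistedGen hn 2 = dswap (coord hn 1) (coord hn 2) * dswap (coord hn 5) (coord hn 6) := by
  rw [twistedGen_block hn (by norm_num),
    show blockGen ⟨2, by norm_num⟩ = (dswap 1 2, 1) * (dswap 5 6, 1) from rfl, map_mul,
    blockHom_dswap, blockHom_dswap]
  rfl

theorem twistedGen_mul_self (i : ℕ) : twistedGen hn i * twistedGen hn i = 1 := by
  rcases lt_or_ge i 3 with h3 | h3
  · rw [twistedGen_block hn h3, ← map_mul, blockGen_mul_self, map_one]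
  rcases lt_or_ge (i + 4) n with hi | hi
  · rw [twistedGen_of_ge hn h3 hi, dswap_mul_self]
  · rw [twistedGen_eq_one hn hi, one_mul]

theorem twistedGen_mem_signedPerms (i : ℕ) : twistedGen hn i ∈ signedPerms (Fin n) := by
  rcases lt_or_ge i 3 with h3 | h3
  · interval_cases i
    · rw [twistedGen_zero]
      exact mul_mem (mul_mem (dswap_mem_signedPerms _ _) (dswap_mem_signedPerms _ _))
        (negFrom_mem_signedPerms _)
    · rw [twistedGen_one]
      exact mul_mem (mul_mem (mul_mem (dswap_mem_signedPerms _ _) (dswap_mem_signedPerms _ _))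
        (negFrom_mem_signedPerms _)) (dswap_mem_signedPerms _ _)
    · rw [twistedGen_two]
      exact mul_mem (dswap_mem_signedPerms _ _) (dswap_mem_signedPerms _ _)
  rcases lt_or_ge (i + 4) n with hi | hi
  · rw [twistedGen_of_ge hn h3 hi]
    exact dswap_mem_signedPerms _ _
  · rw [twistedGen_eq_one hn hi]
    exact one_mem _

theorem pairSwap_commute_negAt {i : Fin n} (hi : 4 ≤ (i : ℕ)) :
    Commute (pairSwap hn) (negAt i) := by
  refine ((dswap_commute_negAt ?_ ?_).mul_left (dswap_commute_negAt ?_ ?_)).mul_left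
    (negFrom_commute_negAt 5 i) <;> simp only [coord, ne_eq, Fin.ext_iff] <;> omega

theorem pairSwap_commute_dswap {a b : Fin n} (ha : 4 ≤ (a : ℕ)) (hb : 4 ≤ (b : ℕ)) :
    Commute (pairSwap hn) (dswap a b) := by
  refine ((dswap_commute ?_ ?_ ?_ ?_).mul_left (dswap_commute ?_ ?_ ?_ ?_)).mul_left
    (negFrom_commute_dswap (by omega) (by omega)) <;>
    simp only [coord, ne_eq, Fin.ext_iff] <;> omega

theorem pairSwap_mul_self : pairSwap hn * pairSwap hn = 1 := by
  rw [← blockHom_blockPairSwap hn (by omega), ← map_mul,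
    show blockPairSwap * blockPairSwap = 1 by decide +kernel, map_one]

theorem twistedGen_two_mul_three_pow :
    (twistedGen hn 2 * twistedGen hn 3) ^ 3 = dswap (coord hn 1) (coord hn 2) := by
  rw [twistedGen_two, twistedGen_of_ge hn le_rfl (by omega)]
  refine mul_mul_pow_three (dswap_mul_self _ _) (dswap_mul_dswap_pow_three ?_ ?_ ?_)
    ((dswap_commute ?_ ?_ ?_ ?_).mul_right (dswap_commute ?_ ?_ ?_ ?_)) <;>
    simp only [coord, ne_eq, Fin.ext_iff] <;> omega

theorem twistedGen_one_mul_dswap_pow_three :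
    (twistedGen hn 1 * dswap (coord hn 5) (coord hn 6)) ^ 3 = pairSwap hn := by
  rw [twistedGen_one]
  refine mul_mul_pow_three (pairSwap_mul_self hn) (dswap_mul_dswap_pow_three ?_ ?_ ?_)
    ((pairSwap_commute_dswap hn ?_ ?_).mul_right (pairSwap_commute_dswap hn ?_ ?_)) <;>
    simp only [coord, ne_eq, Fin.ext_iff] <;> omega

theorem twistedGen_commute_dswap {i : ℕ} {a b : Fin n} (ha : i + 4 < a) (hb : i + 4 < b)
    (ha5 : 5 < (a : ℕ)) (hb5 : 5 < (b : ℕ)) : Commute (twistedGen hn i) (dswap a b) := by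
  rcases lt_or_ge i 3 with h3 | h3
  · interval_cases i
    · rw [twistedGen_zero]
      refine ((dswap_commute ?_ ?_ ?_ ?_).mul_left (dswap_commute ?_ ?_ ?_ ?_)).mul_left
        (negFrom_commute_dswap (by omega) (by omega)) <;>
        simp only [coord, ne_eq, Fin.ext_iff] <;> omega
    · rw [twistedGen_one]
      refine (pairSwap_commute_dswap hn (by omega) (by omega)).mul_left
        (dswap_commute ?_ ?_ ?_ ?_) <;> simp only [coord, ne_eq, Fin.ext_iff] <;> omega
    · rw [twistedGen_two]
      refine (dswap_commute ?_ ?_ ?_ ?_).mul_left (dswap_commute ?_ ?_ ?_ ?_) <;>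
        simp only [coord, ne_eq, Fin.ext_iff] <;> omega
  · rw [twistedGen_of_ge hn h3 (by omega)]
    refine dswap_commute ?_ ?_ ?_ ?_ <;> simp only [ne_eq, Fin.ext_iff] <;> omega

theorem twistedGen_commute_negAt {i : ℕ} {k : Fin n} (hik : i + 4 < k) (hk : 6 < (k : ℕ)) :
    Commute (twistedGen hn i) (negAt k) := by
  rcases lt_or_ge i 3 with h3 | h3
  · interval_cases i
    · rw [twistedGen_zero]
      refine ((dswap_commute_negAt ?_ ?_).mul_left (dswap_commute_negAt ?_ ?_)).mul_left
        (negFrom_commute_negAt 4 k) <;> simp only [coord, ne_eq, Fin.ext_iff] <;> omega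
    · rw [twistedGen_one]
      refine (pairSwap_commute_negAt hn (by omega)).mul_left (dswap_commute_negAt ?_ ?_) <;>
        simp only [coord, ne_eq, Fin.ext_iff] <;> omega
    · rw [twistedGen_two]
      refine (dswap_commute_negAt ?_ ?_).mul_left (dswap_commute_negAt ?_ ?_) <;>
        simp only [coord, ne_eq, Fin.ext_iff] <;> omega
  · rw [twistedGen_of_ge hn h3 (by omega)]
    refine dswap_commute_negAt ?_ ?_ <;> simp only [ne_eq, Fin.ext_iff] <;> omega

theorem twistedGen_commute {i j : ℕ} (hij : i + 2 ≤ j) :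
    Commute (twistedGen hn i) (twistedGen hn j) := by
  rcases lt_or_ge j 3 with h3 | h3
  · obtain ⟨rfl, rfl⟩ : i = 0 ∧ j = 2 := by omega
    rw [twistedGen_block hn (by norm_num), twistedGen_block hn (by norm_num)]
    refine Commute.map ?_ _
    change blockGen 0 * blockGen 2 = blockGen 2 * blockGen 0
    decide +kernel
  rcases lt_or_ge (j + 4) n with hj | hj
  · rw [twistedGen_of_ge hn h3 hj]
    apply twistedGen_commute_dswap <;> simp only <;> omega
  · rw [twistedGen_eq_one hn hj]
    exact Commute.one_right _

end TwistedGenerators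

section GenSpan

variable {n : ℕ} (hn : 8 ≤ n)

theorem genSpan_le_intervalPerms {a b : ℕ} (ha : 3 ≤ a) :
    genSpan hn a b ≤ intervalPerms n (a + 3) (b + 3) := by
  refine genSubgroup_le.2 fun i hi => ?_
  rw [Set.mem_Ico] at hi
  rcases lt_or_ge (i + 4) n with hin | hin
  · rw [twistedGen_of_ge hn (by omega) hin]
    exact dswap_mem_intervalPerms (i := i + 3) hin (by omega) (by omega)
  · rw [twistedGen_eq_one hn hin]
    exact one_mem _

theorem intervalPerms_le_genSpan {a b : ℕ} (ha : 3 ≤ a) :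
    intervalPerms n (a + 3) (b + 3) ≤ genSpan hn a b := by
  refine intervalPerms_le fun i hi hai hib => ?_
  obtain ⟨j, rfl⟩ : ∃ j, i = j + 3 := ⟨i - 3, by omega⟩
  have hj : twistedGen hn j ∈ genSpan hn a b :=
    mem_genSubgroup (Set.mem_Ico.2 ⟨by omega, by omega⟩)
  rwa [twistedGen_of_ge hn (by omega) hi] at hj

theorem genSpan_two_le {b : ℕ} :
    genSpan hn 2 b ≤ Subgroup.zpowers (dswap (coord hn 1) (coord hn 2)) ⊔
      intervalPerms n 5 (b + 3) := by
  refine genSubgroup_le.2 fun i hi => ?_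
  rw [Set.mem_Ico] at hi
  rcases hi.1.eq_or_lt with rfl | h3
  · rw [twistedGen_two]
    exact Subgroup.mul_mem_sup (Subgroup.mem_zpowers _)
      (dswap_mem_intervalPerms (i := 5) (by omega) le_rfl (by omega))
  · exact Subgroup.mem_sup_right (intervalPerms_mono (by norm_num) le_rfl
      (genSpan_le_intervalPerms hn le_rfl (mem_genSubgroup (Set.mem_Ico.2 ⟨h3, hi.2⟩))))

theorem le_genSpan_two {b : ℕ} (hb : 4 ≤ b) :
    Subgroup.zpowers (dswap (coord hn 1) (coord hn 2)) ⊔ intervalPerms n 5 (b + 3) ≤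
      genSpan hn 2 b := by
  have h2 : twistedGen hn 2 ∈ genSpan hn 2 b :=
    mem_genSubgroup (Set.mem_Ico.2 ⟨le_rfl, by omega⟩)
  have h3 : twistedGen hn 3 ∈ genSpan hn 2 b :=
    mem_genSubgroup (Set.mem_Ico.2 ⟨by omega, by omega⟩)
  have h12 : dswap (coord hn 1) (coord hn 2) ∈ genSpan hn 2 b := by
    rw [← twistedGen_two_mul_three_pow hn]
    exact pow_mem (mul_mem h2 h3) 3
  refine sup_le (Subgroup.zpowers_le.2 h12) (intervalPerms_le fun i hi h5i hib => ?_)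
  rcases h5i.eq_or_lt with rfl | h6i
  · rw [twistedGen_two] at h2
    exact (Subgroup.mul_mem_cancel_left _ h12).1 h2
  · exact genSubgroup_mono (Set.Ico_subset_Ico_left (by norm_num))
      (intervalPerms_le_genSpan hn le_rfl (dswap_mem_intervalPerms hi h6i hib))

/-- The group generated by `pairSwap` and the transposition `(2 3)`. -/
def headGroup : Subgroup (Equiv.Perm (Fin n ⊕ Fin n)) :=
  Subgroup.closure {pairSwap hn, dswap (coord hn 1) (coord hn 2)}

theorem pairSwap_mem_headGroup : pairSwap hn ∈ headGroup hn :=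
  Subgroup.subset_closure (Set.mem_insert _ _)

theorem dswap_mem_headGroup : dswap (coord hn 1) (coord hn 2) ∈ headGroup hn :=
  Subgroup.subset_closure (Set.mem_insert_of_mem _ rfl)

theorem commute_of_mem_headGroup {h s : Equiv.Perm (Fin n ⊕ Fin n)} (hh : h ∈ headGroup hn)
    (hs : s ∈ intervalPerms n 4 n) : Commute h s := by
  have hle : intervalPerms n 4 n ≤ Subgroup.centralizer (headGroup hn : Set _) := by
    rw [headGroup, Subgroup.centralizer_closure]
    refine intervalPerms_le fun i hi h4 _ => Subgroup.mem_centralizer_iff.2 ?_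
    rintro _ (rfl | rfl)
    · exact pairSwap_commute_dswap hn h4 (h4.trans i.le_succ)
    · apply dswap_commute <;> simp only [coord, ne_eq, Fin.ext_iff] <;> omega
  exact Subgroup.mem_centralizer_iff.1 (hle hs) h hh

theorem headGroup_commute_negAt {h : Equiv.Perm (Fin n ⊕ Fin n)} (hh : h ∈ headGroup hn)
    {i : Fin n} (hi : 4 ≤ (i : ℕ)) : Commute h (negAt i) := by
  have hle : headGroup hn ≤ Subgroup.centralizer {negAt i} := by
    rw [headGroup, Subgroup.closure_le]
    rintro _ (rfl | rfl) <;> refine Subgroup.mem_centralizer_singleton_iff.2 ?_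
    · exact pairSwap_commute_negAt hn hi
    · apply dswap_commute_negAt <;> simp only [coord, ne_eq, Fin.ext_iff] <;> omega
  exact Subgroup.mem_centralizer_singleton_iff.1 (hle hh)

theorem genSpan_commute_negAt {a b : ℕ} (hb : 3 ≤ b) {k : Fin n} (hk : b + 3 < k)
    {g : Equiv.Perm (Fin n ⊕ Fin n)} (hg : g ∈ genSpan hn a b) : Commute g (negAt k) := by
  have hle : genSpan hn a b ≤ Subgroup.centralizer {negAt k} := by
    refine genSubgroup_le.2 fun i hi => Subgroup.mem_centralizer_singleton_iff.2 ?_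
    rw [Set.mem_Ico] at hi
    exact twistedGen_commute_negAt hn (by omega) (by omega)
  exact Subgroup.mem_centralizer_singleton_iff.1 (hle hg)

theorem genSpan_one_le {b : ℕ} (hb : 3 ≤ b) :
    genSpan hn 1 b ≤ headGroup hn ⊔ intervalPerms n 4 (b + 3) := by
  refine genSubgroup_le.2 fun i hi => ?_
  rw [Set.mem_Ico] at hi
  rcases hi.1.eq_or_lt with rfl | h2
  · rw [twistedGen_one]
    exact Subgroup.mul_mem_sup (pairSwap_mem_headGroup hn)
      (dswap_mem_intervalPerms (i := 4) (by omega) le_rfl (by omega))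
  · exact sup_le_sup (Subgroup.zpowers_le.2 (dswap_mem_headGroup hn))
      (intervalPerms_mono (by norm_num) le_rfl)
      (genSpan_two_le hn (mem_genSubgroup (Set.mem_Ico.2 ⟨h2, hi.2⟩)))

theorem le_genSpan_one {b : ℕ} (hb : 4 ≤ b) :
    headGroup hn ⊔ intervalPerms n 4 (b + 3) ≤ genSpan hn 1 b := by
  have htwo := (le_genSpan_two hn hb).trans
    (genSubgroup_mono (Set.Ico_subset_Ico_left one_le_two))
  have h1 : twistedGen hn 1 ∈ genSpan hn 1 b :=
    mem_genSubgroup (Set.mem_Ico.2 ⟨le_rfl, by omega⟩)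
  have hX : pairSwap hn ∈ genSpan hn 1 b := by
    rw [← twistedGen_one_mul_dswap_pow_three hn]
    exact pow_mem (mul_mem h1 (htwo (Subgroup.mem_sup_right
      (dswap_mem_intervalPerms (i := 5) (by omega) le_rfl (by omega))))) 3
  have h12 : dswap (coord hn 1) (coord hn 2) ∈ genSpan hn 1 b :=
    htwo (Subgroup.mem_sup_left (Subgroup.mem_zpowers _))
  refine sup_le ((Subgroup.closure_le _).2 (Set.insert_subset hX (Set.singleton_subset_iff.2 h12)))
    (intervalPerms_le fun i hi h4i hib => ?_)
  rcases h4i.eq_or_lt with rfl | h5i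
  · rw [twistedGen_one] at h1
    exact (Subgroup.mul_mem_cancel_left _ hX).1 h1
  · exact htwo (Subgroup.mem_sup_right (dswap_mem_intervalPerms hi h5i hib))

end GenSpan

section BlockImage

variable {n : ℕ} (hn : 8 ≤ n)

theorem map_genSubgroup_blockGen (J : Set (Fin 3)) :
    (genSubgroup blockGen J).map (blockHom (n := n) (by omega)) =
      genSubgroup (twistedGen hn) (Fin.val '' J) := by
  rw [map_genSubgroup, ← genSubgroup_comp]
  congr 1
  exact funext fun i => (twistedGen_block hn i.isLt).symm

theorem map_genSubgroup_blockGen_zero_one :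
    (genSubgroup blockGen {0, 1}).map (blockHom (n := n) (by omega)) = genSpan hn 0 2 := by
  rw [map_genSubgroup_blockGen hn, Set.image_pair]
  congr 1
  ext i
  simp only [Set.mem_insert_iff, Set.mem_singleton_iff, Set.mem_Ico, Fin.val_zero, Fin.val_one]
  omega

theorem map_genSubgroup_blockGen_one_two :
    (genSubgroup blockGen {1, 2}).map (blockHom (n := n) (by omega)) = genSpan hn 1 3 := by
  rw [map_genSubgroup_blockGen hn, Set.image_pair]
  congr 1
  ext i
  simp only [Set.mem_insert_iff, Set.mem_singleton_iff, Set.mem_Ico, Fin.val_one, Fin.val_two]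
  omega

theorem genSpan_three_le {a : ℕ} :
    genSpan hn a 3 ≤
      ((specialSignedPerms (Fin 7)).prod ⊤).map (blockHom (n := n) (by omega)) := by
  refine genSubgroup_le.2 fun i hi => ?_
  rw [twistedGen_block hn hi.2]
  exact Subgroup.mem_map_of_mem _ ⟨blockGen_fst_mem_specialSignedPerms _, Subgroup.mem_top _⟩

theorem dswap_notMem_genSpan {a : ℕ} {i j : Fin 7} (hij : i ≠ j) :
    dswap (Fin.castLE (by omega) i) (Fin.castLE (by omega) j) ∉ genSpan hn a 3 := fun h => by
  obtain ⟨q, hq, hqij⟩ := genSpan_three_le hn h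
  rw [← blockHom_dswap] at hqij
  obtain rfl := blockHom_injective (by omega) hqij
  exact dswap_notMem_specialSignedPerms hij hq.1

end BlockImage

section Intersections

variable {n : ℕ} (hn : 8 ≤ n)

theorem mem_sup_intervalPerms {H : Subgroup (Equiv.Perm (Fin n ⊕ Fin n))} (hH : H ≤ headGroup hn)
    {b p : ℕ} (hb : 3 ≤ b) (hp : 4 ≤ p) (hbn : b + 4 < n) {g : Equiv.Perm (Fin n ⊕ Fin n)}
    (hg : g ∈ H ⊔ intervalPerms n p (b + 4)) (hg0 : g ∈ genSpan hn 0 b) :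
    g ∈ H ⊔ intervalPerms n p (b + 3) := by
  obtain ⟨h, hh, s, hs, rfl⟩ := exists_mul_eq_of_mem_sup_of_commute
    (fun h hh s hs => commute_of_mem_headGroup hn (hH hh) (intervalPerms_mono hp hbn.le hs)) hg
  have hhc : Commute h (negAt ⟨b + 3 + 1, hbn⟩) :=
    headGroup_commute_negAt hn (hH hh) (Nat.le_add_left 4 b)
  have hgc : Commute (h * s) (negAt ⟨b + 3 + 1, hbn⟩) :=
    genSpan_commute_negAt hn hb (Nat.lt_succ_self _) hg0
  have hsc : Commute s (negAt ⟨b + 3 + 1, hbn⟩) := by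
    simpa only [inv_mul_cancel_left] using hhc.inv_left.mul_left hgc
  exact Subgroup.mul_mem_sup hh (mem_intervalPerms_of_commute_negAt hbn hs hsc)

theorem genSpan_inf_le_of_two_le {a b : ℕ} (ha : 2 ≤ a) (hab : a < b) (hb : b + 4 < n) :
    genSpan hn a b ⊓ genSpan hn (a + 1) (b + 1) ≤ genSpan hn (a + 1) b := by
  rintro g ⟨hg, hg'⟩
  refine intervalPerms_le_genSpan hn (by omega) (mem_intervalPerms_of_commute_negAt hb
    (genSpan_le_intervalPerms hn (by omega) hg') ?_)
  exact genSpan_commute_negAt hn (by omega) (Nat.lt_succ_self _) hg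

theorem genSpan_inf_le_of_succ {a : ℕ} (ha : a < 2) :
    genSpan hn a (a + 1) ⊓ genSpan hn (a + 1) (a + 1 + 1) ≤ ⊥ := by
  rintro g ⟨hg, hg'⟩
  rw [SetLike.mem_coe, genSpan, Set.Ico_add_one_right_eq_Icc, Set.Icc_self,
    genSubgroup_singleton] at hg hg'
  rcases eq_one_or_eq_of_mem_zpowers (twistedGen_mul_self hn a) hg with rfl | rfl
  · exact one_mem _
  rcases eq_one_or_eq_of_mem_zpowers (twistedGen_mul_self hn (a + 1)) hg' with h | h
  · exact h
  · rw [twistedGen_block hn (by omega), twistedGen_block hn (by omega)] at h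
    have := Fin.ext_iff.1 (blockGen_injective (blockHom_injective (by omega) h))
    simp at this

theorem genSpan_zero_two_inf_le : genSpan hn 0 2 ⊓ genSpan hn 1 3 ≤ genSpan hn 1 2 := by
  rw [← map_genSubgroup_blockGen_zero_one hn, ← map_genSubgroup_blockGen_one_two hn,
    ← Subgroup.map_inf _ _ _ (blockHom_injective (by omega))]
  refine (Subgroup.map_mono genSubgroup_blockGen_inf).trans ?_
  rw [map_genSubgroup_blockGen hn, Set.image_singleton]
  exact genSubgroup_mono (by simp)

theorem genSpan_one_inf_le {b : ℕ} (hb : 3 ≤ b) (hbn : b + 4 < n) :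
    genSpan hn 1 b ⊓ genSpan hn 2 (b + 1) ≤ genSpan hn 2 b := by
  rintro g ⟨hg, hg'⟩
  have hsup := mem_sup_intervalPerms hn (Subgroup.zpowers_le.2 (dswap_mem_headGroup hn)) hb
    (by norm_num) hbn (genSpan_two_le hn hg')
    (genSubgroup_mono (Set.Ico_subset_Ico_left zero_le_one) hg)
  rcases hb.eq_or_lt with rfl | hb4
  · have hle : intervalPerms n 5 6 ≤ Subgroup.zpowers (dswap (coord hn 5) (coord hn 6)) :=
      intervalPerms_le fun i _ h5 h6 => by
        obtain rfl : i = 5 := by omega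
        exact Subgroup.mem_zpowers _
    obtain ⟨h, hh, s, hs, rfl⟩ := exists_mul_eq_of_mem_sup_of_commute (fun h hh s hs =>
      commute_of_mem_headGroup hn (Subgroup.zpowers_le.2 (dswap_mem_headGroup hn) hh)
        (intervalPerms_mono (by norm_num) (by omega) hs)) hsup
    rcases eq_one_or_eq_of_mem_zpowers (dswap_mul_self _ _) hh with rfl | rfl <;>
      rcases eq_one_or_eq_of_mem_zpowers (dswap_mul_self _ _) (hle hs) with rfl | rfl
    · rw [one_mul]
      exact one_mem _
    · rw [one_mul] at hg
      exact absurd hg (dswap_notMem_genSpan hn (i := 5) (j := 6) (by decide))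
    · rw [mul_one] at hg
      exact absurd hg (dswap_notMem_genSpan hn (i := 1) (j := 2) (by decide))
    · rw [← twistedGen_two]
      exact mem_genSubgroup (by simp)
  · exact le_genSpan_two hn hb4 hsup

theorem headGroup_sup_le_map_blockTail : headGroup hn ⊔ intervalPerms n 4 6 ≤
    blockTail.map (blockHom (n := n) (by omega)) := by
  have hdswap : ∀ i j : Fin 7, (dswap i j, 1) ∈ blockTail → dswap (Fin.castLE (by omega) i)
      (Fin.castLE (by omega) j) ∈ blockTail.map (blockHom (n := n) (by omega)) := fun i j h => by
    rw [← blockHom_dswap]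
    exact Subgroup.mem_map_of_mem _ h
  refine sup_le ((Subgroup.closure_le _).2 ?_) (intervalPerms_le fun i _ h4 h6 => ?_)
  · rintro _ (rfl | rfl)
    · rw [← blockHom_blockPairSwap hn (by omega)]
      exact Subgroup.mem_map_of_mem _ (Subgroup.subset_closure (by simp))
    · exact hdswap 1 2 (Subgroup.subset_closure (by simp))
  · obtain rfl | rfl : i = 4 ∨ i = 5 := by omega
    · exact hdswap 4 5 (Subgroup.subset_closure (by simp))
    · exact hdswap 5 6 (Subgroup.subset_closure (by simp))

theorem genSpan_zero_inf_le {b : ℕ} (hb : 3 ≤ b) (hbn : b + 4 < n) :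
    genSpan hn 0 b ⊓ genSpan hn 1 (b + 1) ≤ genSpan hn 1 b := by
  rintro g ⟨hg, hg'⟩
  have hsup := mem_sup_intervalPerms hn le_rfl hb le_rfl hbn (genSpan_one_le hn (by omega) hg') hg
  rcases hb.eq_or_lt with rfl | hb4
  · obtain ⟨q, hq, rfl⟩ := headGroup_sup_le_map_blockTail hn hsup
    rcases mem_or_mul_mem_of_mem_blockTail hq with h | h <;>
      have h13 := Subgroup.mem_map_of_mem (blockHom (n := n) (by omega)) h <;>
      rw [map_genSubgroup_blockGen_one_two hn] at h13
    · exact h13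
    · rw [map_mul, blockHom_dswap] at h13
      have h03 := genSubgroup_mono (Set.Ico_subset_Ico_left zero_le_one) h13
      exact absurd ((Subgroup.mul_mem_cancel_right _ hg).1 h03)
        (dswap_notMem_genSpan hn (by decide))
  · exact le_genSpan_one hn hb4 hsup

theorem genSpan_inf_le {a b : ℕ} (hab : a < b) (hb : b + 4 < n) :
    genSpan hn a b ⊓ genSpan hn (a + 1) (b + 1) ≤ genSpan hn (a + 1) b := by
  rcases lt_or_ge a 2 with ha | ha
  · rcases (Nat.succ_le_of_lt hab).eq_or_lt with rfl | hab
    · exact (genSpan_inf_le_of_succ hn ha).trans bot_le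
    rcases lt_or_ge b 3 with hb3 | hb3
    · obtain ⟨rfl, rfl⟩ : a = 0 ∧ b = 2 := by omega
      exact genSpan_zero_two_inf_le hn
    · interval_cases a
      · exact genSpan_zero_inf_le hn hb3 hb
      · exact genSpan_one_inf_le hn hb3 hb
  · exact genSpan_inf_le_of_two_le hn ha hab hb

theorem signedPerms_le_genSpan : signedPerms (Fin n) ≤ genSpan hn 0 (n - 4) := by
  have hone := (le_genSpan_one hn (b := n - 4) (by omega)).trans
    (genSubgroup_mono (Set.Ico_subset_Ico_left zero_le_one))
  have hhead := le_sup_left.trans hone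
  have htail := le_sup_right.trans hone
  obtain ⟨h34, h01, h23, hneg⟩ := dswap_mem_of_blockGen_mem
    (H := (genSpan hn 0 (n - 4)).comap (blockHom (by omega)))
    (Subgroup.mem_comap.2 (by
      rw [← twistedGen_block hn (by norm_num)]
      exact mem_genSubgroup (Set.mem_Ico.2 ⟨le_rfl, by omega⟩)))
    (Subgroup.mem_comap.2 (by
      rw [blockHom_blockPairSwap hn]
      exact hhead (pairSwap_mem_headGroup hn)))
    (Subgroup.mem_comap.2 (by
      rw [blockHom_dswap]
      exact hhead (dswap_mem_headGroup hn)))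
    (Subgroup.mem_comap.2 (by
      rw [blockHom_dswap]
      exact htail (dswap_mem_intervalPerms (i := 4) (by omega) le_rfl (by omega))))
  rw [Subgroup.mem_comap, blockHom_dswap] at h34 h01 h23
  rw [Subgroup.mem_comap, blockHom_negAt] at hneg
  refine signedPerms_le ?_ hneg
  rintro _ ⟨σ, rfl⟩
  refine mem_of_adjacent_swap_mem (H := (genSpan hn 0 (n - 4)).comap (diagHom _)) (p := 0)
    (q := n) (fun i hi _ _ => ?_) fun i hi => absurd hi (by omega)
  rw [Subgroup.mem_comap, ← dswap_eq_diagHom]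
  rcases lt_or_ge i 4 with hi4 | hi4
  · interval_cases i
    · exact h01
    · exact hhead (dswap_mem_headGroup hn)
    · exact h23
    · exact h34
  · exact htail (dswap_mem_intervalPerms hi hi4 (by omega))

end Intersections

/-! ### Normal subgroups of the group of signed permutations -/

section NormalSubgroups

theorem exists_perm_apply_eq {α : Type*} {a b c d : α} (hab : a ≠ b) (hcd : c ≠ d) :
    ∃ σ : Equiv.Perm α, σ a = c ∧ σ b = d :=
  (MulAction.is_two_pretransitive_iff (G := Equiv.Perm α)).1
    (Equiv.Perm.isMultiplyPretransitive α 2) hab hcd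

variable {α : Type*} [DecidableEq α] {M : Subgroup (Equiv.Perm (α ⊕ α))}

theorem negAt_mul_negAt_mem (hM : signedPerms α ≤ Subgroup.normalizer (M : Set _)) {i j : α}
    (hij : i ≠ j) (h : negAt i * negAt j ∈ M) (a b : α) : negAt a * negAt b ∈ M := by
  rcases eq_or_ne a b with rfl | hab
  · rw [negAt_mul_self]
    exact one_mem M
  obtain ⟨σ, rfl, rfl⟩ := exists_perm_apply_eq hij hab
  have hσ := diagHom_mem_signedPerms σ
  have hconj := conj_mem_of_mem_normalizer (hM hσ) h
  rwa [← conj_mul, conj_negAt hσ, conj_negAt hσ, absPerm_diagHom] at hconj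

theorem negAt_mul_negAt_mem_of_signChange_mem
    (hM : signedPerms α ≤ Subgroup.normalizer (M : Set _)) {ε : α → ℤˣ} (hε : signChange ε ∈ M)
    {i j : α} (hij : ε i ≠ ε j) : negAt i * negAt j ∈ M := by
  have hne : i ≠ j := fun h => hij (congrArg ε h)
  have hconj := conj_mem_of_mem_normalizer (hM (diagHom_mem_signedPerms (Equiv.swap i j))) hε
  rw [diagHom_mul_signChange, mul_inv_cancel_right] at hconj
  convert mul_mem hconj hε using 1
  rw [negAt, negAt, ← map_mul, ← map_mul]
  congr 1
  ext1 k
  have hmul : ε i * ε j = -1 := by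
    rw [Int.units_ne_iff_eq_neg.1 hij, neg_mul, Int.units_mul_self]
  rcases eq_or_ne k i with rfl | hki
  · simp [hne, mul_comm (ε j), hmul]
  rcases eq_or_ne k j with rfl | hkj
  · simp [hne.symm, hmul]
  · simp [hki, hkj, Equiv.swap_apply_of_ne_of_ne hki hkj, Int.units_mul_self]

theorem sumComm_mem_or_negAt_mul_negAt_mem
    (hM : signedPerms α ≤ Subgroup.normalizer (M : Set _)) (hle : M ≤ signedPerms α)
    (hbot : M ≠ ⊥) :
    Equiv.sumComm α α ∈ M ∨ ∃ i j, i ≠ j ∧ negAt i * negAt j ∈ M := by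
  obtain ⟨g, hgM, hg1⟩ := M.bot_or_exists_ne_one.resolve_left hbot
  have hg := hle hgM
  by_cases hmove : ∃ i, absPerm ⟨g, hg⟩ i ≠ i
  · obtain ⟨i, hi⟩ := hmove
    have hcomm := mul_mem hgM
      (conj_mem_of_mem_normalizer (hM (negAt_mem_signedPerms i)) (inv_mem hgM))
    rw [← mul_assoc, ← mul_assoc, conj_negAt hg, negAt_inv] at hcomm
    exact Or.inr ⟨_, i, hi, hcomm⟩
  · push Not at hmove
    obtain ⟨ε, hε⟩ := exists_eq_signChange_mul_diagHom hg
    rw [show absPerm ⟨g, hg⟩ = 1 from Equiv.ext hmove, map_one, mul_one] at hε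
    subst hε
    by_cases hconst : ∀ i j, ε i = ε j
    · left
      obtain ⟨i, hi⟩ : ∃ i, ε i ≠ 1 := by
        by_contra! h
        exact hg1 (by rw [show ε = 1 from funext h, map_one])
      rwa [show ε = -1 from
        funext fun j => (hconst j i).trans ((Int.units_eq_one_or _).resolve_left hi),
        signChange_neg_one] at hgM
    · push Not at hconst
      obtain ⟨i, j, hij⟩ := hconst
      exact Or.inr ⟨i, j, fun h => hij (congrArg ε h),
        negAt_mul_negAt_mem_of_signChange_mem hM hgM hij⟩

theorem sumComm_mem_of_negAt_mul_negAt_mem [Fintype α] (hα : Even (Fintype.card α))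
    (h : ∀ a b : α, negAt a * negAt b ∈ M) : Equiv.sumComm α α ∈ M := by
  rcases isEmpty_or_nonempty α with _ | ⟨⟨b⟩⟩
  · rw [Subsingleton.elim (Equiv.sumComm α α) 1]
    exact one_mem M
  have hprod : ∏ a : α, Pi.mulSingle a (-1) * Pi.mulSingle b (-1) ∈ M.comap signChange :=
    prod_mem fun a _ => by
      rw [Subgroup.mem_comap, map_mul]
      exact h a b
  rwa [Finset.prod_mul_distrib, Finset.prod_const, Finset.card_univ, ← Pi.mulSingle_pow,
    hα.neg_one_pow, Pi.mulSingle_one, mul_one,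
    show ∏ a : α, Pi.mulSingle a (-1 : ℤˣ) = -1 from Finset.univ_prod_mulSingle (-1),
    Subgroup.mem_comap, signChange_neg_one] at hprod

omit [DecidableEq α] in
theorem sumComm_mem_of_normalized [Fintype α] (hα : Even (Fintype.card α))
    (hM : signedPerms α ≤ Subgroup.normalizer (M : Set _)) (hle : M ≤ signedPerms α)
    (hbot : M ≠ ⊥) : Equiv.sumComm α α ∈ M := by
  classical
  rcases sumComm_mem_or_negAt_mul_negAt_mem hM hle hbot with h | ⟨i, j, hij, h⟩
  · exact h
  · exact sumComm_mem_of_negAt_mul_negAt_mem hα (negAt_mul_negAt_mem hM hij h)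

end NormalSubgroups

section DSwapOrder

variable {n : ℕ}

theorem diagHom_injective {α : Type*} : Function.Injective (diagHom α) := fun _ _ h =>
  Equiv.ext fun i => Sum.inl_injective (DFunLike.congr_fun h (Sum.inl i))

theorem dswap_ne_one {a b : Fin n} (hab : a ≠ b) : dswap a b ≠ 1 := by
  rw [dswap_eq_diagHom, Ne, map_eq_one_iff _ diagHom_injective, Equiv.swap_eq_one_iff]
  exact hab

theorem orderOf_dswap {a b : Fin n} (hab : a ≠ b) : orderOf (dswap a b) = 2 :=
  orderOf_eq_prime (by rw [sq, dswap_mul_self]) (dswap_ne_one hab)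

theorem orderOf_dswap_mul_dswap {a b c : Fin n} (hab : a ≠ b) (hac : a ≠ c) (hbc : b ≠ c) :
    orderOf (dswap a b * dswap b c) = 3 := by
  rw [dswap_eq_diagHom, dswap_eq_diagHom, ← map_mul, orderOf_injective _ diagHom_injective,
    Equiv.swap_comm a b]
  exact (Equiv.Perm.isThreeCycle_swap_mul_swap_same hab.symm hbc hac).orderOf

theorem dswap_mem_of_dswap_mem {M : Subgroup (Equiv.Perm (Fin n ⊕ Fin n))}
    (hM : signedPerms (Fin n) ≤ Subgroup.normalizer (M : Set _)) {a b c d : Fin n} (hab : a ≠ b)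
    (hcd : c ≠ d) (h : dswap a b ∈ M) : dswap c d ∈ M := by
  obtain ⟨σ, rfl, rfl⟩ := exists_perm_apply_eq hab hcd
  rw [← conj_diagHom_dswap]
  exact conj_mem_of_mem_normalizer (hM (diagHom_mem_signedPerms σ)) h

end DSwapOrder

/-! ### The C-string -/

section TPerm

variable {n : ℕ} (hn : 8 ≤ n)

theorem tPerm_zero : tPerm n hn ⟨0, by omega⟩ =
    blockHom (k := 7) (by omega) (dswap 1 2 * dswap 3 4 * negFrom 7 6, -1) := by
  rw [show (dswap 1 2 * dswap 3 4 * negFrom 7 6, (-1 : ℤˣ)) =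
    (dswap (1 : Fin 7) 2, (1 : ℤˣ)) * (dswap 3 4, 1) * (negFrom 7 6, -1) from rfl, map_mul, map_mul,
    blockHom_dswap, blockHom_dswap, blockHom_negFrom _ (by norm_num)]
  rfl

theorem tPerm_one : tPerm n hn ⟨1, by omega⟩ =
    blockHom (k := 7) (by omega) (dswap 0 1 * dswap 2 3 * dswap 4 5 * negFrom 7 7, -1) := by
  rw [show (dswap 0 1 * dswap 2 3 * dswap 4 5 * negFrom 7 7, (-1 : ℤˣ)) =
    (dswap (0 : Fin 7) 1, (1 : ℤˣ)) * (dswap 2 3, 1) * (dswap 4 5, 1) * (negFrom 7 7, -1) from rfl,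
    map_mul, map_mul, map_mul, blockHom_dswap, blockHom_dswap, blockHom_dswap,
    blockHom_negFrom _ (by norm_num)]
  rfl

theorem tPerm_two : tPerm n hn ⟨2, by omega⟩ =
    blockHom (k := 7) (by omega) (dswap 1 2 * dswap 5 6, 1) := by
  rw [show (dswap 1 2 * dswap 5 6, (1 : ℤˣ)) = (dswap (1 : Fin 7) 2, (1 : ℤˣ)) * (dswap 5 6, 1)
    from rfl, map_mul, blockHom_dswap, blockHom_dswap]
  rfl

theorem tPerm_of_ge {i : ℕ} (h : 3 ≤ i) (hi : i < n - 4) :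
    tPerm n hn ⟨i, hi⟩ = dswap ⟨i + 3, by omega⟩ ⟨i + 4, by omega⟩ := by
  rw [tPerm, if_neg (by simp only; omega), if_neg (by simp only; omega),
    if_neg (by simp only; omega)]
  rfl

theorem conj_tPerm (i : Fin (n - 4)) :
    negAt (coord hn 4) * tPerm n hn i * (negAt (coord hn 4))⁻¹ = twistedGen hn i := by
  obtain ⟨i, hi⟩ := i
  rcases lt_or_ge i 3 with h3 | h3
  · have hneg : negAt (coord hn 4) = blockHom (k := 7) (by omega) (negAt 4, 1) :=
      (blockHom_negAt (show 7 ≤ n by omega) 4).symm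
    rw [twistedGen_block hn h3, hneg, ← map_inv]
    interval_cases i
    · rw [tPerm_zero, ← map_mul, ← map_mul]
      exact congrArg _ (by decide +revert +kernel)
    · rw [tPerm_one, ← map_mul, ← map_mul]
      exact congrArg _ (by decide +revert +kernel)
    · rw [tPerm_two, ← map_mul, ← map_mul]
      exact congrArg _ (by decide +revert +kernel)
  · rw [twistedGen_of_ge hn h3 (by omega), tPerm_of_ge hn h3, mul_inv_eq_iff_eq_mul]
    refine (dswap_commute_negAt ?_ ?_).symm <;> simp only [coord, ne_eq, Fin.ext_iff] <;> omega

theorem tPerm_mem_signedPerms (i : Fin (n - 4)) : tPerm n hn i ∈ signedPerms (Fin n) := by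
  have h := twistedGen_mem_signedPerms hn i
  have hneg := negAt_mem_signedPerms (coord hn 4)
  rwa [← conj_tPerm, Subgroup.mul_mem_cancel_right _ (inv_mem hneg),
    Subgroup.mul_mem_cancel_left _ hneg] at h

end TPerm

section Orders

variable {n : ℕ} (hn : 8 ≤ n)

theorem orderOf_twistedGen {i : ℕ} (hi : i + 4 < n) : orderOf (twistedGen hn i) = 2 := by
  refine orderOf_eq_prime (by rw [sq, twistedGen_mul_self]) ?_
  rcases lt_or_ge i 3 with h3 | h3
  · rw [twistedGen_block hn h3, Ne, map_eq_one_iff _ (blockHom_injective (by omega))]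
    have hne : ∀ j, blockGen j ≠ 1 := by decide +kernel
    exact hne _
  · rw [twistedGen_of_ge hn h3 hi]
    exact dswap_ne_one (by simp)

theorem orderOf_blockGen_zero_mul_one : orderOf (blockGen 0 * blockGen 1) = 12 := by
  have hne : ∀ m : Fin 12, 0 < (m : ℕ) → (blockGen 0 * blockGen 1) ^ (m : ℕ) ≠ 1 := by
    decide +kernel
  exact (orderOf_eq_iff (by norm_num)).2 ⟨by decide +kernel, fun m hm hpos => hne ⟨m, hm⟩ hpos⟩

theorem orderOf_blockGen_one_mul_two : orderOf (blockGen 1 * blockGen 2) = 12 := by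
  have hne : ∀ m : Fin 12, 0 < (m : ℕ) → (blockGen 1 * blockGen 2) ^ (m : ℕ) ≠ 1 := by
    decide +kernel
  exact (orderOf_eq_iff (by norm_num)).2 ⟨by decide +kernel, fun m hm hpos => hne ⟨m, hm⟩ hpos⟩

theorem orderOf_twistedGen_zero_mul_one :
    orderOf (twistedGen hn 0 * twistedGen hn 1) = 12 := by
  rw [twistedGen_block hn (by norm_num), twistedGen_block hn (by norm_num), ← map_mul,
    orderOf_injective _ (blockHom_injective (by omega))]
  exact orderOf_blockGen_zero_mul_one

theorem orderOf_twistedGen_one_mul_two :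
    orderOf (twistedGen hn 1 * twistedGen hn 2) = 12 := by
  rw [twistedGen_block hn (by norm_num), twistedGen_block hn (by norm_num), ← map_mul,
    orderOf_injective _ (blockHom_injective (by omega))]
  exact orderOf_blockGen_one_mul_two

theorem orderOf_twistedGen_two_mul_three :
    orderOf (twistedGen hn 2 * twistedGen hn 3) = 6 := by
  have hdisj : Commute (dswap (coord hn 1) (coord hn 2))
      (dswap (coord hn 5) (coord hn 6) * dswap (coord hn 6) (coord hn 7)) := by
    refine (dswap_commute ?_ ?_ ?_ ?_).mul_right (dswap_commute ?_ ?_ ?_ ?_) <;> simp [coord]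
  have h2 : orderOf (dswap (coord hn 1) (coord hn 2)) = 2 := orderOf_dswap (by simp [coord])
  have h3 : orderOf (dswap (coord hn 5) (coord hn 6) * dswap (coord hn 6) (coord hn 7)) = 3 := by
    refine orderOf_dswap_mul_dswap ?_ ?_ ?_ <;> simp [coord]
  rw [twistedGen_two, twistedGen_of_ge hn le_rfl (by omega), mul_assoc]
  refine (hdisj.orderOf_mul_eq_mul_orderOf_of_coprime ?_).trans ?_ <;> rw [h2, h3]
  norm_num

theorem orderOf_twistedGen_mul_succ {i : ℕ} (h : 3 ≤ i) (hi : i + 5 < n) :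
    orderOf (twistedGen hn i * twistedGen hn (i + 1)) = 3 := by
  rw [twistedGen_of_ge hn h (by omega), twistedGen_of_ge hn (by omega) (by omega)]
  exact orderOf_dswap_mul_dswap (by simp) (by simp) (by simp)

end Orders

section Main

variable {n : ℕ} (hn : 8 ≤ n)

/-- The representation `signedRep n` of the Coxeter group, conjugated by the sign change of the
fifth coordinate, so that it takes the generators `t_{i+1}` to `twistedGen hn i`. -/
noncomputable def twistedRep : (CoxeterMatrix.B n).Group →* Equiv.Perm (Fin n ⊕ Fin n) :=
  (MulAut.conj (negAt (coord hn 4))).toMonoidHom.comp (signedRep n)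

theorem twistedRep_apply (g : (CoxeterMatrix.B n).Group) :
    twistedRep hn g = negAt (coord hn 4) * signedRep n g * (negAt (coord hn 4))⁻¹ := rfl

theorem twistedRep_injective : Function.Injective (twistedRep hn) :=
  (MulAut.conj (negAt (coord hn 4))).injective.comp (signedRep_injective n)

theorem range_twistedRep : (twistedRep hn).range = signedPerms (Fin n) := by
  rw [twistedRep, MonoidHom.range_comp, range_signedRep (by omega)]
  exact Subgroup.mem_normalizer_iff_map_conj_eq.1
    (Subgroup.le_normalizer (negAt_mem_signedPerms _))

variable {t : Fin (n - 4) → (CoxeterMatrix.B n).Group}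

theorem isCString_of_twistedRep (ht : ∀ i, twistedRep hn (t i) = twistedGen hn i) :
    IsCString t := by
  refine IsCString.of_injective (twistedRep_injective hn) ht
    (fun i hi => orderOf_twistedGen hn (by omega)) (fun _ _ => twistedGen_commute hn)
    (fun a b hab hb => genSpan_inf_le hn hab (by omega)) ?_
  rw [range_twistedRep, ← Set.Ico_bot]
  exact signedPerms_le_genSpan hn

theorem schlafliSymbol_of_twistedRep (ht : ∀ i, twistedRep hn (t i) = twistedGen hn i) :
    schlafliSymbol t = 12 :: 12 :: 6 :: List.replicate (n - 8) 3 := by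
  have horder : ∀ i (hi : i + 1 < n - 4), orderOf (t ⟨i, by omega⟩ * t ⟨i + 1, hi⟩) =
      orderOf (twistedGen hn i * twistedGen hn (i + 1)) := fun i hi => by
    rw [← orderOf_injective _ (twistedRep_injective hn), map_mul, ht, ht]
  have hlen : (schlafliSymbol t).length = n - 4 - 1 := List.length_ofFn
  refine List.ext_getElem ?_ fun i hi _ => ?_
  · rw [hlen, List.length_cons, List.length_cons, List.length_cons, List.length_replicate]
    omega
  · rw [hlen] at hi
    simp only [schlafliSymbol, List.getElem_ofFn, horder i (by omega)]
    rcases i with _ | _ | _ | i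
    · exact orderOf_twistedGen_zero_mul_one hn
    · exact orderOf_twistedGen_one_mul_two hn
    · exact orderOf_twistedGen_two_mul_three hn
    · simp only [List.getElem_cons_succ, List.getElem_replicate]
      exact orderOf_twistedGen_mul_succ hn (by omega) (by omega)

/-! ### Quotients -/

theorem dswap_mem_genSpan_two_four :
    dswap (coord hn 1) (coord hn 2) ∈ genSpan hn 2 4 := by
  rw [← twistedGen_two_mul_three_pow]
  exact pow_mem (mul_mem (mem_genSubgroup (by simp)) (mem_genSubgroup (by simp))) 3

theorem dswap_mul_sumComm_mem_genSpan_zero_three :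
    dswap (coord hn 1) (coord hn 2) * Equiv.sumComm (Fin n) (Fin n) ∈ genSpan hn 0 3 := by
  have hmem : ∀ i : Fin 3, blockGen i ∈
      (genSpan hn 0 3).comap (blockHom (k := 7) (n := n) (by omega)) := fun i => by
    rw [Subgroup.mem_comap, ← twistedGen_block hn i.2]
    exact mem_genSubgroup (by simp)
  have hword := mul_mem (mul_mem (mul_mem (mul_mem (mul_mem
    (pow_mem (mul_mem (mul_mem (hmem 1) (hmem 2)) (hmem 0)) 4)
    (pow_mem (mul_mem (hmem 1) (hmem 0)) 2))
    (pow_mem (mul_mem (mul_mem (hmem 1) (hmem 2)) (hmem 0)) 3)) (hmem 1)) (hmem 0)) (hmem 1)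
  rw [blockGen_word, Subgroup.mem_comap, map_mul, blockHom_dswap,
    blockHom_negFrom _ (by norm_num), negFrom_one] at hword
  exact hword

theorem map_genSubgroup_eq_genSpan (ht : ∀ i, twistedRep hn (t i) = twistedGen hn i) {a b : ℕ}
    (hb : b ≤ n - 4) :
    (genSubgroup t (Fin.val ⁻¹' Set.Ico a b)).map (twistedRep hn) = genSpan hn a b := by
  rw [map_genSubgroup, funext ht, genSubgroup_comp, Set.image_preimage_eq_of_subset]
  exact fun i hi => ⟨⟨i, hi.2.trans_le hb⟩, rfl⟩

theorem exists_dswap_mem_map (ht : ∀ i, twistedRep hn (t i) = twistedGen hn i)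
    {N : Subgroup (CoxeterMatrix.B n).Group} [N.Normal]
    (hC : IsCString fun i => (t i : (CoxeterMatrix.B n).Group ⧸ N))
    (hN : Equiv.sumComm (Fin n) (Fin n) ∈ N.map (twistedRep hn)) :
    ∃ a b, a ≠ b ∧ dswap a b ∈ N.map (twistedRep hn) := by
  obtain ⟨c, hc, hc'⟩ := hN
  have hlift : ∀ {a b : ℕ} {g}, b ≤ n - 4 → g ∈ genSpan hn a b →
      ∃ x ∈ genSubgroup t (Fin.val ⁻¹' Set.Ico a b), twistedRep hn x = g := fun hb hg => by
    rwa [← map_genSubgroup_eq_genSpan hn ht hb, Subgroup.mem_map] at hg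
  obtain ⟨x, hx, hx'⟩ := hlift (by omega) (dswap_mem_genSpan_two_four hn)
  obtain ⟨y, hy, hy'⟩ := hlift (by omega) (dswap_mul_sumComm_mem_genSpan_zero_three hn)
  have hxy : x⁻¹ * y = c := twistedRep_injective hn <| by
    rw [map_mul, map_inv, hx', hy', hc', inv_mul_cancel_left]
  obtain ⟨z, hz, hzx⟩ := exists_mem_genSubgroup_inter (f := QuotientGroup.mk' N)
    (hC.intersection _ _).le hx hy (QuotientGroup.eq.2 (hxy ▸ hc))
  have hz' : twistedRep hn z ∈ Subgroup.zpowers (twistedGen hn 2) := by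
    rw [← genSubgroup_singleton, ← Set.Icc_self, ← Set.Ico_add_one_right_eq_Icc]
    change _ ∈ genSpan hn 2 3
    rw [← map_genSubgroup_eq_genSpan hn ht (by omega)]
    rw [← Set.preimage_inter, Set.Ico_inter_Ico] at hz
    exact Subgroup.mem_map_of_mem _ hz
  have hM : dswap (coord hn 1) (coord hn 2) * twistedRep hn z ∈ N.map (twistedRep hn) := by
    have := Subgroup.mem_map_of_mem (twistedRep hn) (QuotientGroup.eq.1 hzx.symm)
    rwa [map_mul, map_inv, hx', dswap_inv] at this
  rcases eq_one_or_eq_of_mem_zpowers (twistedGen_mul_self hn 2) hz' with h | h <;> rw [h] at hM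
  · exact ⟨coord hn 1, coord hn 2, by simp [coord], by rwa [mul_one] at hM⟩
  · refine ⟨coord hn 5, coord hn 6, by simp [coord], ?_⟩
    rwa [twistedGen_two, ← mul_assoc, dswap_mul_self, one_mul] at hM

theorem not_isCString_quotient (ht : ∀ i, twistedRep hn (t i) = twistedGen hn i) (he : Even n)
    {N : Subgroup (CoxeterMatrix.B n).Group} [N.Normal] (hN : N ≠ ⊥) :
    ¬ IsCString fun i => (t i : (CoxeterMatrix.B n).Group ⧸ N) := by
  intro hC
  have hinj := twistedRep_injective hn
  have hM : signedPerms (Fin n) ≤ Subgroup.normalizer (N.map (twistedRep hn) : Set _) := by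
    have := Subgroup.le_normalizer_map (H := N) (twistedRep hn)
    rwa [Subgroup.normalizer_eq_top, ← MonoidHom.range_eq_map, range_twistedRep] at this
  have hle : N.map (twistedRep hn) ≤ signedPerms (Fin n) :=
    (Subgroup.map_le_range _ _).trans (range_twistedRep hn).le
  have hneg := sumComm_mem_of_normalized (by rwa [Fintype.card_fin]) hM hle
    (by rwa [Ne, Subgroup.map_eq_bot_iff_of_injective _ hinj])
  obtain ⟨a, b, hab, hmem⟩ := exists_dswap_mem_map hn ht hC hneg
  have hthree : twistedRep hn (t ⟨3, by omega⟩) ∈ N.map (twistedRep hn) := by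
    rw [ht, twistedGen_of_ge hn le_rfl (by omega)]
    exact dswap_mem_of_dswap_mem hM hab (by simp) hmem
  have horder := hC.involution ⟨3, by omega⟩
  rw [(QuotientGroup.eq_one_iff _).2 ((Subgroup.mem_map_iff_mem hinj).1 hthree),
    orderOf_one] at horder
  exact absurd horder (by norm_num)

end Main

theorem theorem1p3 (n : ℕ) (hn : 8 ≤ n) :
    ∃ ρ : (CoxeterMatrix.B n).Group →* Equiv.Perm (Fin n ⊕ Fin n),
      Function.Injective ρ ∧
      (∀ j : Fin n, ρ ((CoxeterMatrix.B n).simple j.rev) = betaPerm j) ∧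
      ∃ t : Fin (n - 4) → (CoxeterMatrix.B n).Group,
        (∀ i, ρ (t i) = tPerm n hn i) ∧
        IsCString t ∧
        schlafliSymbol t = 12 :: 12 :: 6 :: List.replicate (n - 8) 3 ∧
        (Even n → IsUnravelledCString t) := by
  refine ⟨signedRep n, signedRep_injective n, signedRep_simple, ?_⟩
  have htPerm : ∀ i, tPerm n hn i ∈ (signedRep n).range := fun i => by
    rw [range_signedRep (by omega)]
    exact tPerm_mem_signedPerms hn i
  choose t ht using htPerm
  have ht' : ∀ i, twistedRep hn (t i) = twistedGen hn i := fun i => by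
    rw [twistedRep_apply, ht, conj_tPerm]
  have hC := isCString_of_twistedRep hn ht'
  refine ⟨t, ht, hC, schlafliSymbol_of_twistedRep hn ht', fun he => ⟨hC, fun N _ hN _ => ?_⟩⟩
  have hNC := not_isCString_quotient hn ht' he hN
  by_cases hinj : Function.Injective fun i => (t i : (CoxeterMatrix.B n).Group ⧸ N)
  · exact Or.inr ⟨hinj, hNC⟩
  · exact Or.inl hinj
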